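/- Let $s,k\ge 1$ be integers, let $\theta(n)=\mathrm{sign}(n)+1$, and consider $s$-tuples $(M_{21},M_{43},\dots,M_{2s,2s-1})$ of invertible complex $k\times k$ matrices; $M_{2j,2j-1}$ is the monodromy datum of the $j$-th interior hole of $\Sigma_{0,s+1,1}$, a disc with $s$ holes and one bordered cusp on its outer boundary. The Poisson algebra of monodromy data is given by the following brackets of matrix entries. For the entries of one matrix $M=M_{2j,2j-1}$, $$\{m_{a,b},m_{c,d}\}=-\delta_{b,c}\sum_t m_{a,t}m_{t,d}\,\theta(t-b)+\delta_{a,d}\sum_t m_{t,b}m_{c,t}\,\theta(t-a)+m_{c,b}m_{a,d}\bigl(\theta(d-b)-\theta(c-a)\bigr),$$ and for $M=M_{2i,2i-1}$, $N=M_{2j,2j-1}$ with $i<j$, $$\{m_{a,b},n_{c,d}\}=\delta_{b,c}\sum_t m_{a,t}n_{t,d}\,\theta(b-t)-m_{a,d}n_{c,b}\,\theta(b-d)+\delta_{a,d}\sum_t m_{t,b}n_{c,t}\,\theta(t-a)-m_{c,b}n_{a,d}\,\theta(c-a).$$ Put $M_B=M_{21}M_{43}\cdots M_{2s,2s-1}$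 and impose on the boundary datum $M_B=(m_{B,i,j})$ the restriction $m_{B,i,j}=0$ for all $i+j\ge k+2$. Let $X$ be the resulting space of tuples, and let $X_1\subset X$ be the subspace of tuples of matrices in $SL_k(\mathbb C)$. The restriction is compatible with the bracket: on $X$ the entries $m_{B,i,j}$ with $i+j\ge k+2$ Poisson commute with all functions. (1) The maximal dimension of the Poisson leaves (that is, symplectic leaves, with complex dimension) of $X$ is $$D=sk(k-1)-\frac{k(k-1)}2-\left[\frac k2\right],$$ and this is also the maximal dimension of the Poisson leaves contained in $X_1$. (2) The $sk$ functions $\mathrm{tr}\,M_{2j,2j-1}^p$ ($1\le j\le s$, $1\le p\le k$) and the $[k/2]$ functions $C_i=m_{B,i,k+1-i}/m_{B,k+1-i,i}$ ($1\le i\le [k/2]$), whose denominators do not vanish on $X$, are Casimirs: on $X$ they Poisson commute with all functions. (3) These $sk+[k/2]$ Casimirs are independent and complete: for all $x$ in a dense subset of $X$, and also for all $x$ in a dense subset of $X_1$, the Poisson leaf through $x$ has dimension $D$ and the differentials of these functions at $x$, restricted to $T_xX$, form a basis of the kernel of the Poisson tensor of $X$ on $T_x^*X$. -/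

import Mathlib

open scoped BigOperators Topology

noncomputable section

namespace MonodromyAlgebra

/-- Labels of the matrix entries of `s` matrices of size `k × k`: the label `(j, a, b)` stands for
the `(a, b)` entry of the `j`-th matrix. -/
abbrev Coord (s k : ℕ) : Type := Fin s × Fin k × Fin k

/-- The space of `s`-tuples of complex `k × k` matrices, in coordinates. -/
abbrev Phase (s k : ℕ) : Type := Coord s k → ℂ

variable {s k : ℕ}

/-- The `j`-th monodromy matrix (the matrix of the loop around the `j`-th hole, whose two ends
have numbers `2j` and `2j - 1` when `j` is counted from `1`). -/
def mon (x : Phase s k) (j : Fin s) : Matrix (Fin k) (Fin k) ℂ :=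
  Matrix.of fun a b => x (j, a, b)

/-- The boundary monodromy matrix: the product, in increasing order, of all monodromy matrices. -/
def boundary (x : Phase s k) : Matrix (Fin k) (Fin k) ℂ :=
  (List.ofFn fun j : Fin s => mon x j).prod

/-- `theta a b` is `θ(a - b)`, where `θ(n) = sign(n) + 1`. -/
def theta (a b : Fin k) : ℂ :=
  ((Int.sign (((a : ℕ) : ℤ) - ((b : ℕ) : ℤ)) + 1 : ℤ) : ℂ)

/-- The bracket `{A_{ij}, A_{pl}}` of two entries of one monodromy matrix `A`. -/
def sameBracket (A : Matrix (Fin k) (Fin k) ℂ) (i j p l : Fin k) : ℂ :=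
  -(if j = p then ∑ t, A i t * A t l * theta t j else 0)
    + (if i = l then ∑ t, A t j * A p t * theta t i else 0)
    + A p j * A i l * (theta l j - theta p i)

/-- The bracket `{A_{ij}, B_{pl}}` of entries of two monodromy matrices, where `A` precedes `B`
in the ordering of the holes. -/
def crossBracket (A B : Matrix (Fin k) (Fin k) ℂ) (i j p l : Fin k) : ℂ :=
  (if j = p then ∑ t, A i t * B t l * theta j t else 0)
    - A i l * B p j * theta j l
    + (if i = l then ∑ t, A t j * B p t * theta t i else 0)
    - A p j * B i l * theta p i

/-- The Poisson bivector: the bracket at `x` of the two coordinate functions `c` and `c'`. -/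
def coordBracket (x : Phase s k) (c c' : Coord s k) : ℂ :=
  if c.1 = c'.1 then
    sameBracket (mon x c.1) c.2.1 c.2.2 c'.2.1 c'.2.2
  else if c.1 < c'.1 then
    crossBracket (mon x c.1) (mon x c'.1) c.2.1 c.2.2 c'.2.1 c'.2.2
  else
    -crossBracket (mon x c'.1) (mon x c.1) c'.2.1 c'.2.2 c.2.1 c.2.2

/-- The bracket of two functions, extended from the coordinate functions as a biderivation. -/
def poissonBracket (f g : Phase s k → ℂ) (x : Phase s k) : ℂ :=
  ∑ c, ∑ c', fderiv ℂ f x (Pi.single c 1) * fderiv ℂ g x (Pi.single c' 1) * coordBracket x c c'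

/-- The anchor map of the bivector at `x`, from covectors to tangent vectors. It sends `df` to the
Hamiltonian vector of `f`, whose `c'`-component is `{f, x_{c'}}`. -/
def sharp (x : Phase s k) : (Phase s k →L[ℂ] ℂ) →ₗ[ℂ] Phase s k where
  toFun α := fun c' => ∑ c, α (Pi.single c 1) * coordBracket x c c'
  map_add' α β := by
    funext c'
    simp [add_mul, Finset.sum_add_distrib]
  map_smul' r α := by
    funext c'
    simp [Finset.mul_sum, mul_assoc]

/-- Positions strictly below the main anti-diagonal: with row and column numbers starting at `1`
this is the condition `i + j ≥ k + 2`. -/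
def BelowAnti (a b : Fin k) : Prop :=
  k + 2 ≤ ((a : ℕ) + 1) + ((b : ℕ) + 1)

/-- The restricted phase space: tuples of invertible matrices whose product vanishes below the
main anti-diagonal. -/
def restrictedPhase (s k : ℕ) : Set (Phase s k) :=
  {x | (∀ j, (mon x j).det ≠ 0) ∧ ∀ a b, BelowAnti a b → boundary x a b = 0}

/-- The part of the restricted phase space consisting of tuples of matrices of determinant one. -/
def restrictedPhaseSL (s k : ℕ) : Set (Phase s k) :=
  {x | x ∈ restrictedPhase s k ∧ ∀ j, (mon x j).det = 1}

/-- The tangent space at `x` of the restricted phase space: the common kernel of the differentials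
of its defining equations. -/
def tangentSpace (x : Phase s k) : Submodule ℂ (Phase s k) where
  carrier := {v | ∀ a b, BelowAnti a b → fderiv ℂ (fun y : Phase s k => boundary y a b) x v = 0}
  add_mem' hv hw := fun a b h => by rw [map_add, hv a b h, hw a b h, add_zero]
  zero_mem' := fun a b _ => map_zero _
  smul_mem' r v hv := fun a b h => by rw [map_smul, hv a b h, smul_zero]

/-- A cotangent vector of the ambient space restricted to the tangent space of the restricted phase
space. Every cotangent vector of the restricted phase space at `x` is of this form. -/
def restrictCovector (x : Phase s k) : (Phase s k →L[ℂ] ℂ) →ₗ[ℂ] (tangentSpace x →ₗ[ℂ] ℂ) where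
  toFun α := α.toLinearMap.domRestrict (tangentSpace x)
  map_add' _ _ := rfl
  map_smul' _ _ := rfl

/-- `f` is a Casimir of the Poisson structure on the restricted phase space. -/
def IsCasimir (f : Phase s k → ℂ) : Prop :=
  ∀ x ∈ restrictedPhase s k, DifferentiableAt ℂ f x ∧
    ∀ g : Phase s k → ℂ, DifferentiableAt ℂ g x → poissonBracket f g x = 0

/-- The Poisson (symplectic) leaf through `x` of the restricted phase space: all end points of
cotangent paths that start at `x`, that is, of `C¹` paths `γ` in the restricted phase space with
`γ'(t) = sharp (α(t))` for a continuous family of covectors `α(t)` at `γ(t)`. -/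
def leaf (x : Phase s k) : Set (Phase s k) :=
  {y | ∃ (γ : ℝ → Phase s k) (α : ℝ → (Phase s k →L[ℂ] ℂ)),
    ContinuousOn α (Set.Icc 0 1) ∧ γ 0 = x ∧ γ 1 = y ∧
    ∀ t ∈ Set.Icc (0 : ℝ) 1, γ t ∈ restrictedPhase s k ∧
      HasDerivWithinAt γ (sharp (γ t) (α t)) (Set.Icc 0 1) t}

/-- The leaf through `x` has complex dimension `d`: it has a holomorphic chart at `x`, that is, an
injective holomorphic immersion `φ` of a neighbourhood of `0` in `ℂ^d` into the leaf with
`φ 0 = x`, whose tangent space at each point consists of all Hamiltonian vectors there. -/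
def LeafHasDim (x : Phase s k) (d : ℕ) : Prop :=
  ∃ (U : Set (Fin d → ℂ)) (φ : (Fin d → ℂ) → Phase s k),
    IsOpen U ∧ (0 : Fin d → ℂ) ∈ U ∧ φ 0 = x ∧ Set.InjOn φ U ∧ DifferentiableOn ℂ φ U ∧
    ∀ u ∈ U, φ u ∈ leaf x ∧ Function.Injective (fderiv ℂ φ u) ∧
      Set.range (fderiv ℂ φ u) = Set.range (sharp (φ u))

/-- The function `tr (M_j ^ p)`. -/
def traceFun (j : Fin s) (p : ℕ) (x : Phase s k) : ℂ :=
  (mon x j ^ p).trace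

/-- The row number `i ≤ [k/2]` as a row number of a `k × k` matrix. -/
def halfIndex (i : Fin (k / 2)) : Fin k :=
  Fin.castLE (Nat.div_le_self k 2) i

/-- The ratio `m_{i,k+1-i} / m_{k+1-i,i}` of anti-diagonal entries of the boundary matrix
(`Fin.rev` is `i ↦ k + 1 - i` when rows are counted from `1`). -/
def ratioFun (i : Fin (k / 2)) (x : Phase s k) : ℂ :=
  boundary x (halfIndex i) (Fin.rev (halfIndex i)) /
    boundary x (Fin.rev (halfIndex i)) (halfIndex i)

/-- The list of the `s k` functions `tr (M_j ^ p)`, `1 ≤ p ≤ k`, followed by the `[k/2]` ratios. -/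
def casimirFun : (Fin s × Fin k) ⊕ Fin (k / 2) → Phase s k → ℂ
  | Sum.inl jp => traceFun jp.1 ((jp.2 : ℕ) + 1)
  | Sum.inr i => ratioFun i

/-- At `x` the differentials of the listed functions on the restricted phase space form a basis of
the kernel of its Poisson tensor. -/
def CasimirsCompleteAt (x : Phase s k) : Prop :=
  LinearIndependent ℂ (fun i => restrictCovector x (fderiv ℂ (casimirFun i) x)) ∧
    Submodule.span ℂ (Set.range fun i => restrictCovector x (fderiv ℂ (casimirFun i) x)) =
      (LinearMap.ker (sharp x)).map (restrictCovector x)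

/-- `s k (k - 1) - k (k - 1) / 2 - [k/2]`; for `s ≥ 1` no subtraction is truncated. -/
def maxLeafDim (s k : ℕ) : ℕ :=
  s * (k * (k - 1)) - k * (k - 1) / 2 - k / 2

end MonodromyAlgebra

end

noncomputable section

namespace MonodromyAlgebra

variable {s k : ℕ}

/-! Identify a covector with its gradient matrices `G_j` for the trace pairing, and put `C_j = [M_j,
G_j]` and `D = ∑ C_j`. Contracted with gradients, the brackets collapse to one formula
(`mon_sharp`): a Hamiltonian vector moves `M_i` by `M_i Y_{i+1} - Y_i M_i`, where `Y_0 = -U(D)`,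
`Y_s = L(D)` and `Y_{i+1} = Y_i + 2 C_i`. Here `L` and `U` are the triangular parts with doubled
off-diagonal entries. Eliminating `Y_{i+1}` shows that each `M_i` moves by a commutator, so traces
of powers are Casimirs. Along the product the terms telescope, and `M_B` moves by `M_B L(D) + U(D)
M_B`. For anti-triangular `M_B` this vanishes below the anti-diagonal, and it rescales the entries
at `(a, rev a)` and `(rev a, a)` by the same factor `D_{aa} + D_{rev a, rev a}`, so their ratio is a
Casimir.

Completeness is a two-sided count of the kernel of the Poisson tensor at points where one vector `v`
is cyclic for all `M_j`. The differentials of the Casimirs and of the defining equations lie in the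
kernel and are independent there (`linearIndependent_fderiv_constraintFun`). Conversely a kernel
covector is determined by the vectors `G_j v`, half the diagonal of `D` and its strictly lower
entries (`eq_zero_of_kernelCoord_eq_zero`), which are equally many numbers. Hence these
differentials span the kernel, and the rank is `maxLeafDim s k`.

At such points the inverse function theorem makes the common level set of the constraints a chart of
the leaf (`leafHasDim_of_krylov`). These points are dense: any point is joined by a line-like
deformation to one with a cyclic matrix, and an entire function which is not identically zero has
isolated zeros. Dividing by `k`-th roots of determinants carries density over to `SL_k`. Lower
semicontinuity of the rank bounds every other leaf dimension. -/

/-! ### Triangular parts and the brackets contracted with a gradient -/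

theorem theta_add_theta (a b : Fin k) : theta a b + theta b a = 2 := by
  have h : Int.sign ((a : ℤ) - b) = -Int.sign ((b : ℤ) - a) := by
    rw [← Int.sign_neg, neg_sub]
  simp only [theta]
  rw [h]
  push_cast
  ring

theorem theta_self (a : Fin k) : theta a a = 1 := by
  simp [theta]

theorem theta_of_lt {a b : Fin k} (h : a < b) : theta a b = 0 := by
  have : Int.sign ((a : ℤ) - b) = -1 := Int.sign_eq_neg_one_of_neg (by
    have : (a : ℕ) < b := h
    omega)
  simp [theta, this]

/-- The part of a matrix on and below the diagonal, with the strictly lower entries doubled. -/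
def lowerPart (A : Matrix (Fin k) (Fin k) ℂ) : Matrix (Fin k) (Fin k) ℂ :=
  Matrix.of fun a b => theta a b * A a b

/-- The part of a matrix on and above the diagonal, with the strictly upper entries doubled. -/
def upperPart (A : Matrix (Fin k) (Fin k) ℂ) : Matrix (Fin k) (Fin k) ℂ :=
  Matrix.of fun a b => theta b a * A a b

@[simp] theorem lowerPart_apply (A : Matrix (Fin k) (Fin k) ℂ) (a b : Fin k) :
    lowerPart A a b = theta a b * A a b := rfl

@[simp] theorem upperPart_apply (A : Matrix (Fin k) (Fin k) ℂ) (a b : Fin k) :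
    upperPart A a b = theta b a * A a b := rfl

theorem lowerPart_add_upperPart (A : Matrix (Fin k) (Fin k) ℂ) :
    lowerPart A + upperPart A = (2 : ℂ) • A := by
  ext a b
  simp only [Matrix.add_apply, lowerPart_apply, upperPart_apply, Matrix.smul_apply, smul_eq_mul]
  rw [← add_mul, theta_add_theta]

theorem lowerPart_sum {ι : Type*} (t : Finset ι) (f : ι → Matrix (Fin k) (Fin k) ℂ) :
    lowerPart (∑ i ∈ t, f i) = ∑ i ∈ t, lowerPart (f i) := by
  ext a b
  simp [Matrix.sum_apply, Finset.mul_sum]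

theorem upperPart_sum {ι : Type*} (t : Finset ι) (f : ι → Matrix (Fin k) (Fin k) ℂ) :
    upperPart (∑ i ∈ t, f i) = ∑ i ∈ t, upperPart (f i) := by
  ext a b
  simp [Matrix.sum_apply, Finset.mul_sum]

theorem sum_mul_sameBracket (M G : Matrix (Fin k) (Fin k) ℂ) (c d : Fin k) :
    ∑ a, ∑ b, G b a * sameBracket M a b c d =
      (M * lowerPart (M * G - G * M) + upperPart (M * G - G * M) * M) c d := by
  have e1 : ∑ a, ∑ b, G b a * (if b = c then ∑ t, M a t * M t d * theta t b else 0) =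
      (upperPart (G * M) * M) c d := by
    simp only [mul_ite, mul_zero, Finset.sum_ite_eq', Finset.mem_univ, if_true, Matrix.mul_apply,
      upperPart_apply, Finset.mul_sum, Finset.sum_mul]
    rw [Finset.sum_comm]
    exact Finset.sum_congr rfl fun _ _ => Finset.sum_congr rfl fun _ _ => by ring
  have e2 : ∑ a, ∑ b, G b a * (if a = d then ∑ t, M t b * M c t * theta t a else 0) =
      (M * lowerPart (M * G)) c d := by
    rw [Finset.sum_comm]
    simp only [mul_ite, mul_zero, Finset.sum_ite_eq', Finset.mem_univ, if_true, Matrix.mul_apply,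
      lowerPart_apply, Finset.mul_sum]
    rw [Finset.sum_comm]
    exact Finset.sum_congr rfl fun _ _ => Finset.sum_congr rfl fun _ _ => by ring
  have e3 : ∑ a, ∑ b, G b a * (M c b * M a d * theta d b) = (M * upperPart (G * M)) c d := by
    simp only [Matrix.mul_apply, upperPart_apply, Finset.mul_sum]
    rw [Finset.sum_comm]
    exact Finset.sum_congr rfl fun _ _ => Finset.sum_congr rfl fun _ _ => by ring
  have e4 : ∑ a, ∑ b, G b a * (M c b * M a d * theta c a) = (lowerPart (M * G) * M) c d := by
    simp only [Matrix.mul_apply, lowerPart_apply, Finset.mul_sum, Finset.sum_mul]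
    exact Finset.sum_congr rfl fun _ _ => Finset.sum_congr rfl fun _ _ => by ring
  have h1 : lowerPart (M * G - G * M) = lowerPart (M * G) - lowerPart (G * M) := by
    ext; simp [mul_sub]
  have h2 : upperPart (M * G - G * M) = upperPart (M * G) - upperPart (G * M) := by
    ext; simp [mul_sub]
  -- Exchanging the triangular parts creates the terms `2 M G M` and `-2 M G M`, which cancel.
  have h3 : upperPart (M * G) = (2 : ℂ) • (M * G) - lowerPart (M * G) := by
    rw [← lowerPart_add_upperPart]; abel
  have h4 : lowerPart (G * M) = (2 : ℂ) • (G * M) - upperPart (G * M) := by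
    rw [← lowerPart_add_upperPart]; abel
  have h5 : M * lowerPart (M * G - G * M) + upperPart (M * G - G * M) * M =
      -(upperPart (G * M) * M) + M * lowerPart (M * G) + M * upperPart (G * M)
        - lowerPart (M * G) * M := by
    rw [h1, h2, h3, h4]
    simp only [mul_sub, sub_mul, mul_smul_comm, smul_mul_assoc, Matrix.mul_assoc]
    abel
  rw [h5]
  simp only [Matrix.sub_apply, Matrix.add_apply, Matrix.neg_apply]
  rw [← e1, ← e2, ← e3, ← e4]
  simp only [← Finset.sum_neg_distrib, ← Finset.sum_add_distrib, ← Finset.sum_sub_distrib]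
  refine Finset.sum_congr rfl fun _ _ => Finset.sum_congr rfl fun _ _ => ?_
  rw [sameBracket]
  ring

/-- An earlier matrix acts on a later one by the commutator with `L(C)`. In
`sum_mul_crossBracket_swap` the later one acts through `U(C)` instead. As both actions depend only
on `C = [M, G]`, they can be added up over all holes. -/
theorem sum_mul_crossBracket (M N G : Matrix (Fin k) (Fin k) ℂ) (c d : Fin k) :
    ∑ a, ∑ b, G b a * crossBracket M N a b c d =
      (N * lowerPart (M * G - G * M) - lowerPart (M * G - G * M) * N) c d := by
  have e1 : ∑ a, ∑ b, G b a * (if b = c then ∑ t, M a t * N t d * theta b t else 0) =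
      (lowerPart (G * M) * N) c d := by
    simp only [mul_ite, mul_zero, Finset.sum_ite_eq', Finset.mem_univ, if_true, Matrix.mul_apply,
      lowerPart_apply, Finset.mul_sum, Finset.sum_mul]
    rw [Finset.sum_comm]
    exact Finset.sum_congr rfl fun _ _ => Finset.sum_congr rfl fun _ _ => by ring
  have e2 : ∑ a, ∑ b, G b a * (M a d * N c b * theta b d) = (N * lowerPart (G * M)) c d := by
    simp only [Matrix.mul_apply, lowerPart_apply, Finset.mul_sum]
    rw [Finset.sum_comm]
    exact Finset.sum_congr rfl fun _ _ => Finset.sum_congr rfl fun _ _ => by ring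
  have e3 : ∑ a, ∑ b, G b a * (if a = d then ∑ t, M t b * N c t * theta t a else 0) =
      (N * lowerPart (M * G)) c d := by
    rw [Finset.sum_comm]
    simp only [mul_ite, mul_zero, Finset.sum_ite_eq', Finset.mem_univ, if_true, Matrix.mul_apply,
      lowerPart_apply, Finset.mul_sum]
    rw [Finset.sum_comm]
    exact Finset.sum_congr rfl fun _ _ => Finset.sum_congr rfl fun _ _ => by ring
  have e4 : ∑ a, ∑ b, G b a * (M c b * N a d * theta c a) = (lowerPart (M * G) * N) c d := by
    simp only [Matrix.mul_apply, lowerPart_apply, Finset.mul_sum, Finset.sum_mul]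
    exact Finset.sum_congr rfl fun _ _ => Finset.sum_congr rfl fun _ _ => by ring
  have h1 : lowerPart (M * G - G * M) = lowerPart (M * G) - lowerPart (G * M) := by
    ext; simp [mul_sub]
  have h5 : N * lowerPart (M * G - G * M) - lowerPart (M * G - G * M) * N =
      lowerPart (G * M) * N - N * lowerPart (G * M) + N * lowerPart (M * G)
        - lowerPart (M * G) * N := by
    rw [h1, mul_sub, sub_mul]
    abel
  rw [h5]
  simp only [Matrix.sub_apply, Matrix.add_apply]
  rw [← e1, ← e2, ← e3, ← e4]
  simp only [← Finset.sum_add_distrib, ← Finset.sum_sub_distrib]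
  refine Finset.sum_congr rfl fun _ _ => Finset.sum_congr rfl fun _ _ => ?_
  rw [crossBracket]
  ring

theorem sum_mul_crossBracket_swap (M N H : Matrix (Fin k) (Fin k) ℂ) (a b : Fin k) :
    ∑ c, ∑ d, H d c * crossBracket M N a b c d =
      (M * upperPart (N * H - H * N) - upperPart (N * H - H * N) * M) a b := by
  have e1 : ∑ c, ∑ d, H d c * (if b = c then ∑ t, M a t * N t d * theta b t else 0) =
      (M * upperPart (N * H)) a b := by
    rw [Finset.sum_comm]
    simp only [mul_ite, mul_zero, Finset.sum_ite_eq, Finset.mem_univ, if_true, Matrix.mul_apply,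
      upperPart_apply, Finset.mul_sum]
    rw [Finset.sum_comm]
    exact Finset.sum_congr rfl fun _ _ => Finset.sum_congr rfl fun _ _ => by ring
  have e2 : ∑ c, ∑ d, H d c * (M a d * N c b * theta b d) = (M * upperPart (H * N)) a b := by
    simp only [Matrix.mul_apply, upperPart_apply, Finset.mul_sum]
    rw [Finset.sum_comm]
    exact Finset.sum_congr rfl fun _ _ => Finset.sum_congr rfl fun _ _ => by ring
  have e3 : ∑ c, ∑ d, H d c * (if a = d then ∑ t, M t b * N c t * theta t a else 0) =
      (upperPart (H * N) * M) a b := by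
    simp only [mul_ite, mul_zero, Finset.sum_ite_eq, Finset.mem_univ, if_true, Matrix.mul_apply,
      upperPart_apply, Finset.mul_sum, Finset.sum_mul]
    rw [Finset.sum_comm]
    exact Finset.sum_congr rfl fun _ _ => Finset.sum_congr rfl fun _ _ => by ring
  have e4 : ∑ c, ∑ d, H d c * (M c b * N a d * theta c a) = (upperPart (N * H) * M) a b := by
    simp only [Matrix.mul_apply, upperPart_apply, Finset.mul_sum, Finset.sum_mul]
    exact Finset.sum_congr rfl fun _ _ => Finset.sum_congr rfl fun _ _ => by ring
  have h1 : upperPart (N * H - H * N) = upperPart (N * H) - upperPart (H * N) := by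
    ext; simp [mul_sub]
  have h5 : M * upperPart (N * H - H * N) - upperPart (N * H - H * N) * M =
      M * upperPart (N * H) - M * upperPart (H * N) + upperPart (H * N) * M
        - upperPart (N * H) * M := by
    rw [h1, mul_sub, sub_mul]
    abel
  rw [h5]
  simp only [Matrix.sub_apply, Matrix.add_apply]
  rw [← e1, ← e2, ← e3, ← e4]
  simp only [← Finset.sum_add_distrib, ← Finset.sum_sub_distrib]
  refine Finset.sum_congr rfl fun _ _ => Finset.sum_congr rfl fun _ _ => ?_
  rw [crossBracket]
  ring

/-! ### Hamiltonian vectors as gauge transformations -/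

/-- The gradient matrix of a covector with respect to the `j`-th matrix, for the trace pairing. -/
def grad (α : Phase s k →L[ℂ] ℂ) (j : Fin s) : Matrix (Fin k) (Fin k) ℂ :=
  Matrix.of fun b a => α (Pi.single (j, a, b) 1)

theorem apply_eq_sum_single (α : Phase s k →L[ℂ] ℂ) (v : Phase s k) :
    α v = ∑ c, α (Pi.single c 1) * v c := by
  conv_lhs => rw [pi_eq_sum_univ' v]
  simp [mul_comm]

theorem apply_eq_sum_trace (α : Phase s k →L[ℂ] ℂ) (v : Phase s k) :
    α v = ∑ j, (grad α j * mon v j).trace := by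
  rw [apply_eq_sum_single, Fintype.sum_prod_type]
  refine Finset.sum_congr rfl fun j _ => ?_
  rw [Fintype.sum_prod_type, Finset.sum_comm]
  rfl

theorem ext_grad {α β : Phase s k →L[ℂ] ℂ} (h : ∀ j, grad α j = grad β j) : α = β := by
  ext v
  rw [apply_eq_sum_trace, apply_eq_sum_trace]
  simp [h]

theorem grad_add (α β : Phase s k →L[ℂ] ℂ) (j : Fin s) :
    grad (α + β) j = grad α j + grad β j := by
  ext; simp [grad]

theorem grad_smul (r : ℂ) (α : Phase s k →L[ℂ] ℂ) (j : Fin s) :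
    grad (r • α) j = r • grad α j := by
  ext; simp [grad]

/-- The commutator of the `j`-th matrix with the gradient of a covector. -/
def gradComm (x : Phase s k) (α : Phase s k →L[ℂ] ℂ) (j : Fin s) : Matrix (Fin k) (Fin k) ℂ :=
  mon x j * grad α j - grad α j * mon x j

/-- The infinitesimal gauge transformation, at the `i`-th vertex, generated by a covector. -/
def gauge (x : Phase s k) (α : Phase s k →L[ℂ] ℂ) (i : ℕ) : Matrix (Fin k) (Fin k) ℂ :=
  ∑ j : Fin s, if (j : ℕ) < i then lowerPart (gradComm x α j) else -upperPart (gradComm x α j)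

/-- Passing from vertex `i` to vertex `i + 1` changes only the summand `j = i` of the gauge matrix,
from `-U(C_i)` to `L(C_i)`; this is the self-bracket. The summands `j < i` and `j > i` enter as
commutators with `M_i`, which are the two cross brackets. -/
theorem mon_sharp (x : Phase s k) (α : Phase s k →L[ℂ] ℂ) (i : Fin s) :
    mon (sharp x α) i = mon x i * gauge x α (i + 1) - gauge x α i * mon x i := by
  rw [gauge, gauge, Finset.mul_sum, Finset.sum_mul, ← Finset.sum_sub_distrib]
  ext c d
  rw [Matrix.sum_apply]
  change ∑ e : Coord s k, α (Pi.single e 1) * coordBracket x e (i, c, d) = _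
  rw [Fintype.sum_prod_type]
  refine Finset.sum_congr rfl fun j _ => ?_
  rw [Fintype.sum_prod_type]
  rcases lt_trichotomy j i with h | h | h
  · have h1 : (j : ℕ) < i := h
    rw [if_pos h1, if_pos (by omega)]
    simp only [coordBracket, if_neg h.ne, if_pos h]
    exact sum_mul_crossBracket (mon x j) (mon x i) (grad α j) c d
  · subst h
    rw [if_pos (by omega), if_neg (by omega)]
    simp only [coordBracket, if_true]
    rw [neg_mul, sub_neg_eq_add]
    exact sum_mul_sameBracket (mon x j) (grad α j) c d
  · have h1 : (i : ℕ) < j := h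
    rw [if_neg (by omega), if_neg (by omega)]
    simp only [coordBracket, if_neg h.ne', if_neg h.asymm]
    have := sum_mul_crossBracket_swap (mon x i) (mon x j) (grad α j) c d
    simp only [mul_neg, Finset.sum_neg_distrib, neg_mul]
    rw [← neg_sub']
    exact congrArg Neg.neg this

theorem gauge_zero (x : Phase s k) (α : Phase s k →L[ℂ] ℂ) :
    gauge x α 0 = -upperPart (∑ j, gradComm x α j) := by
  simp [gauge, upperPart_sum]

theorem gauge_last (x : Phase s k) (α : Phase s k →L[ℂ] ℂ) :
    gauge x α s = lowerPart (∑ j, gradComm x α j) := by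
  simp [gauge, lowerPart_sum]

theorem gauge_succ (x : Phase s k) (α : Phase s k →L[ℂ] ℂ) (i : Fin s) :
    gauge x α (i + 1) = gauge x α i + (2 : ℂ) • gradComm x α i := by
  rw [← sub_eq_iff_eq_add', gauge, gauge, ← Finset.sum_sub_distrib, Finset.sum_eq_single i]
  · rw [if_pos (by omega), if_neg (by omega), sub_neg_eq_add, lowerPart_add_upperPart]
  · intro j _ hj
    have hj' : (j : ℕ) ≠ i := fun h => hj (Fin.ext h)
    by_cases h : (j : ℕ) < i
    · rw [if_pos h, if_pos (by omega), sub_self]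
    · rw [if_neg h, if_neg (by omega), sub_self]
  · simp

/-- Each monodromy matrix moves inside its conjugacy class, which is why its spectral invariants are
Casimirs. -/
theorem mon_sharp_eq_commutator (x : Phase s k) (α : Phase s k →L[ℂ] ℂ) (i : Fin s) :
    mon (sharp x α) i = mon x i * (gauge x α i + (2 : ℂ) • (mon x i * grad α i))
      - (gauge x α i + (2 : ℂ) • (mon x i * grad α i)) * mon x i := by
  rw [mon_sharp, gauge_succ, gradComm]
  simp only [mul_add, add_mul, mul_smul_comm, smul_mul_assoc, smul_sub, mul_sub, Matrix.mul_assoc]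
  abel

theorem sameBracket_swap (A : Matrix (Fin k) (Fin k) ℂ) (i j p l : Fin k) :
    sameBracket A p l i j = -sameBracket A i j p l := by
  have h1 := theta_add_theta l j
  have h2 := theta_add_theta p i
  have e1 : (if l = i then ∑ t, A p t * A t j * theta t l else 0) =
      if i = l then ∑ t, A t j * A p t * theta t i else 0 := by
    by_cases h : i = l
    · subst h; simp [mul_comm]
    · rw [if_neg h, if_neg (Ne.symm h)]
  have e2 : (if p = j then ∑ t, A t l * A i t * theta t p else 0) =
      if j = p then ∑ t, A i t * A t l * theta t j else 0 := by
    by_cases h : j = p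
    · subst h; simp [mul_comm]
    · rw [if_neg h, if_neg (Ne.symm h)]
  rw [sameBracket, sameBracket, e1, e2]
  linear_combination A i l * A p j * (h1 - h2)

theorem coordBracket_swap (x : Phase s k) (c c' : Coord s k) :
    coordBracket x c' c = -coordBracket x c c' := by
  unfold coordBracket
  rcases lt_trichotomy c.1 c'.1 with h | h | h
  · rw [if_neg h.ne', if_neg h.asymm, if_neg h.ne, if_pos h]
  · rw [if_pos h.symm, if_pos h, h, sameBracket_swap]
  · rw [if_neg h.ne, if_pos h, if_neg h.ne', if_neg h.asymm, neg_neg]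

theorem poissonBracket_eq_apply_sharp (f g : Phase s k → ℂ) (x : Phase s k) :
    poissonBracket f g x = -fderiv ℂ f x (sharp x (fderiv ℂ g x)) := by
  rw [apply_eq_sum_single, poissonBracket, ← Finset.sum_neg_distrib]
  refine Finset.sum_congr rfl fun c _ => ?_
  change _ = -(_ * ∑ c', fderiv ℂ g x (Pi.single c' 1) * coordBracket x c' c)
  rw [Finset.mul_sum, ← Finset.sum_neg_distrib]
  refine Finset.sum_congr rfl fun c' _ => ?_
  rw [coordBracket_swap x c c']
  ring

/-- By antisymmetry of the bivector, the annihilator of the range of `sharp x` is contained in its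
kernel. -/
theorem sharp_eq_zero_of_apply_sharp {x : Phase s k} {α : Phase s k →L[ℂ] ℂ}
    (h : ∀ β, α (sharp x β) = 0) : sharp x α = 0 := by
  funext c'
  have := h (ContinuousLinearMap.proj c')
  rw [apply_eq_sum_single] at this
  change ∑ c, α (Pi.single c 1) * coordBracket x c c' = 0
  rw [← neg_eq_zero, ← Finset.sum_neg_distrib, ← this]
  refine Finset.sum_congr rfl fun c _ => ?_
  have e : sharp x (ContinuousLinearMap.proj (R := ℂ) (φ := fun _ => ℂ) c') c =
      coordBracket x c' c := by
    change ∑ d, (Pi.single d (1 : ℂ) : Phase s k) c' * coordBracket x d c = _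
    simp [Pi.single_apply]
  rw [e, coordBracket_swap x c c']
  ring

/-! ### Entrywise calculus for matrix-valued maps -/

section MatrixCalculus

variable {E : Type*} [NormedAddCommGroup E] [NormedSpace ℂ E]

/-- A matrix-valued map all of whose entries are continuously differentiable. -/
def EntrywiseSmooth (f : E → Matrix (Fin k) (Fin k) ℂ) : Prop :=
  ∀ a b, ContDiff ℂ 1 fun y => f y a b

/-- The entrywise directional derivative of a matrix-valued map. -/
def entrywiseDeriv (f : E → Matrix (Fin k) (Fin k) ℂ) (x v : E) : Matrix (Fin k) (Fin k) ℂ :=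
  Matrix.of fun a b => fderiv ℂ (fun y => f y a b) x v

theorem EntrywiseSmooth.const (A : Matrix (Fin k) (Fin k) ℂ) :
    EntrywiseSmooth fun _ : E => A :=
  fun _ _ => contDiff_const

theorem EntrywiseSmooth.mul {f g : E → Matrix (Fin k) (Fin k) ℂ} (hf : EntrywiseSmooth f)
    (hg : EntrywiseSmooth g) : EntrywiseSmooth fun y => f y * g y := by
  intro a b
  simp only [Matrix.mul_apply]
  exact ContDiff.sum fun t _ => (hf a t).mul (hg t b)

theorem EntrywiseSmooth.add {f g : E → Matrix (Fin k) (Fin k) ℂ} (hf : EntrywiseSmooth f)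
    (hg : EntrywiseSmooth g) : EntrywiseSmooth fun y => f y + g y :=
  fun a b => (hf a b).add (hg a b)

theorem EntrywiseSmooth.smul {c : E → ℂ} {f : E → Matrix (Fin k) (Fin k) ℂ}
    (hc : ContDiff ℂ 1 c) (hf : EntrywiseSmooth f) : EntrywiseSmooth fun y => c y • f y :=
  fun a b => hc.mul (hf a b)

theorem EntrywiseSmooth.pow {f : E → Matrix (Fin k) (Fin k) ℂ} (hf : EntrywiseSmooth f) (p : ℕ) :
    EntrywiseSmooth fun y => f y ^ p := by
  induction p with
  | zero => simpa using EntrywiseSmooth.const 1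
  | succ p ih => simpa only [pow_succ] using ih.mul hf

theorem EntrywiseSmooth.list_prod {n : ℕ} {f : Fin n → E → Matrix (Fin k) (Fin k) ℂ}
    (hf : ∀ i, EntrywiseSmooth (f i)) :
    EntrywiseSmooth fun y => (List.ofFn fun i => f i y).prod := by
  induction n with
  | zero => simpa using EntrywiseSmooth.const 1
  | succ n ih =>
    simp only [List.ofFn_succ, List.prod_cons]
    exact (hf 0).mul (ih fun i => hf i.succ)

theorem EntrywiseSmooth.det {f : E → Matrix (Fin k) (Fin k) ℂ} (hf : EntrywiseSmooth f) :
    ContDiff ℂ 1 fun y => (f y).det := by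
  simp only [Matrix.det_apply']
  exact ContDiff.sum fun σ _ => contDiff_const.mul (contDiff_prod fun i _ => hf _ _)

theorem EntrywiseSmooth.adjugate {f : E → Matrix (Fin k) (Fin k) ℂ} (hf : EntrywiseSmooth f) :
    EntrywiseSmooth fun y => (f y).adjugate := by
  intro a b
  simp only [Matrix.adjugate_apply]
  refine EntrywiseSmooth.det fun i j => ?_
  by_cases h : i = b
  · subst h
    simpa using contDiff_const
  · simpa [Matrix.updateRow_ne h] using hf i j

theorem EntrywiseSmooth.trace {f : E → Matrix (Fin k) (Fin k) ℂ} (hf : EntrywiseSmooth f) :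
    ContDiff ℂ 1 fun y => (f y).trace :=
  ContDiff.sum fun i _ => hf i i

theorem EntrywiseSmooth.differentiableAt {f : E → Matrix (Fin k) (Fin k) ℂ}
    (hf : EntrywiseSmooth f) (a b : Fin k) (x : E) : DifferentiableAt ℂ (fun y => f y a b) x :=
  ((hf a b).differentiable one_ne_zero) x

theorem entrywiseDeriv_mul {f g : E → Matrix (Fin k) (Fin k) ℂ} (hf : EntrywiseSmooth f)
    (hg : EntrywiseSmooth g) (x v : E) :
    entrywiseDeriv (fun y => f y * g y) x v =
      entrywiseDeriv f x v * g x + f x * entrywiseDeriv g x v := by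
  ext a b
  simp only [entrywiseDeriv, Matrix.of_apply, Matrix.mul_apply, Matrix.add_apply]
  have h : ∀ t ∈ Finset.univ, HasFDerivAt (fun y => f y a t * g y t b)
      (f x a t • fderiv ℂ (fun y => g y t b) x + g x t b • fderiv ℂ (fun y => f y a t) x) x :=
    fun t _ => (hf.differentiableAt a t x).hasFDerivAt.mul (hg.differentiableAt t b x).hasFDerivAt
  rw [(HasFDerivAt.fun_sum h).fderiv, ← Finset.sum_add_distrib]
  simp only [sum_apply, add_apply,
    smul_apply, smul_eq_mul]
  exact Finset.sum_congr rfl fun _ _ => by ring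

theorem entrywiseDeriv_const (A : Matrix (Fin k) (Fin k) ℂ) (x v : E) :
    entrywiseDeriv (fun _ => A) x v = 0 := by
  ext a b
  simp [entrywiseDeriv]

theorem trace_entrywiseDeriv {f : E → Matrix (Fin k) (Fin k) ℂ} (hf : EntrywiseSmooth f)
    (x v : E) : fderiv ℂ (fun y => (f y).trace) x v = (entrywiseDeriv f x v).trace := by
  have h : ∀ i ∈ Finset.univ, HasFDerivAt (fun y => f y i i) (fderiv ℂ (fun y => f y i i) x) x :=
    fun i _ => (hf.differentiableAt i i x).hasFDerivAt
  have := (HasFDerivAt.fun_sum h).fderiv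
  simp only [Matrix.trace, Matrix.diag_apply]
  rw [this, sum_apply]
  rfl

/-- The extra factor `f x ^ q` is needed for the induction on `p`: cyclicity of the trace moves one
factor of `f x` from the right into it. -/
theorem trace_pow_mul_entrywiseDeriv_pow {f : E → Matrix (Fin k) (Fin k) ℂ}
    (hf : EntrywiseSmooth f) (x v : E) (p q : ℕ) :
    (f x ^ q * entrywiseDeriv (fun y => f y ^ (p + 1)) x v).trace =
      (p + 1) * (f x ^ (q + p) * entrywiseDeriv f x v).trace := by
  induction p generalizing q with
  | zero => simp
  | succ p ih =>
    have h : entrywiseDeriv (fun y => f y ^ (p + 1 + 1)) x v =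
        entrywiseDeriv (fun y => f y ^ (p + 1)) x v * f x
          + f x ^ (p + 1) * entrywiseDeriv f x v := by
      simp only [pow_succ _ (p + 1)]
      exact entrywiseDeriv_mul (hf.pow (p + 1)) hf x v
    rw [h, mul_add, Matrix.trace_add, ← Matrix.mul_assoc, Matrix.trace_mul_comm,
      ← Matrix.mul_assoc, ← pow_succ', ih, ← Matrix.mul_assoc, ← pow_add]
    rw [show q + 1 + p = q + (p + 1) by ring]
    push_cast
    ring

/-- In the Leibniz rule the term `Y (i + 1)` after one factor cancels the same term before the next,
so only the two ends survive. -/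
theorem entrywiseDeriv_list_prod_of_gauge {n : ℕ} {f : Fin n → E → Matrix (Fin k) (Fin k) ℂ}
    (hf : ∀ i, EntrywiseSmooth (f i)) (x v : E) (Y : ℕ → Matrix (Fin k) (Fin k) ℂ)
    (h : ∀ i, entrywiseDeriv (f i) x v = f i x * Y (i + 1) - Y i * f i x) :
    entrywiseDeriv (fun y => (List.ofFn fun i => f i y).prod) x v =
      (List.ofFn fun i => f i x).prod * Y n - Y 0 * (List.ofFn fun i => f i x).prod := by
  induction n generalizing Y with
  | zero => simp [entrywiseDeriv_const]
  | succ n ih =>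
    simp only [List.ofFn_succ, List.prod_cons]
    rw [entrywiseDeriv_mul (hf 0) (EntrywiseSmooth.list_prod fun i => hf i.succ),
      ih (fun i => hf i.succ) (fun i => Y (i + 1)) (fun i => h i.succ), h 0]
    simp only [Fin.val_zero, zero_add, sub_mul, mul_sub, Matrix.mul_assoc]
    abel

end MatrixCalculus

/-! ### Derivatives of the boundary matrix and of the traces -/

theorem entrywiseSmooth_mon (j : Fin s) : EntrywiseSmooth fun y : Phase s k => mon y j :=
  fun a b => contDiff_apply ℂ ℂ (j, a, b)

theorem entrywiseSmooth_boundary : EntrywiseSmooth fun y : Phase s k => boundary y :=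
  EntrywiseSmooth.list_prod fun j => entrywiseSmooth_mon j

theorem entrywiseDeriv_mon (j : Fin s) (x v : Phase s k) :
    entrywiseDeriv (fun y : Phase s k => mon y j) x v = mon v j := by
  ext a b
  exact congrArg (fun L : Phase s k →L[ℂ] ℂ => L v)
    (ContinuousLinearMap.proj (R := ℂ) (φ := fun _ : Coord s k => ℂ) (j, a, b)).fderiv

theorem entrywiseDeriv_boundary_of_gauge (x v : Phase s k) (Y : ℕ → Matrix (Fin k) (Fin k) ℂ)
    (h : ∀ i : Fin s, mon v i = mon x i * Y (i + 1) - Y i * mon x i) :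
    entrywiseDeriv boundary x v = boundary x * Y s - Y 0 * boundary x :=
  entrywiseDeriv_list_prod_of_gauge entrywiseSmooth_mon x v Y fun i => by
    rw [entrywiseDeriv_mon, h]

theorem entrywiseDeriv_boundary_sharp (x : Phase s k) (α : Phase s k →L[ℂ] ℂ) :
    entrywiseDeriv boundary x (sharp x α) =
      boundary x * lowerPart (∑ j, gradComm x α j)
        + upperPart (∑ j, gradComm x α j) * boundary x := by
  rw [entrywiseDeriv_boundary_of_gauge x _ (gauge x α) (mon_sharp x α), gauge_last, gauge_zero]
  rw [neg_mul, sub_neg_eq_add]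

theorem fderiv_traceFun (j : Fin s) (p : ℕ) (x v : Phase s k) :
    fderiv ℂ (traceFun j (p + 1)) x v = (p + 1) * (mon x j ^ p * mon v j).trace := by
  have h := trace_pow_mul_entrywiseDeriv_pow (entrywiseSmooth_mon (k := k) j) x v p 0
  rw [pow_zero, one_mul, zero_add, entrywiseDeriv_mon] at h
  rw [← h]
  exact trace_entrywiseDeriv ((entrywiseSmooth_mon j).pow (p + 1)) x v

theorem fderiv_traceFun_of_commutator (j : Fin s) (p : ℕ) (x v : Phase s k)
    (Y : Matrix (Fin k) (Fin k) ℂ) (h : mon v j = mon x j * Y - Y * mon x j) :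
    fderiv ℂ (traceFun j (p + 1)) x v = 0 := by
  rw [fderiv_traceFun, h, mul_sub, Matrix.trace_sub, ← Matrix.mul_assoc, ← Matrix.mul_assoc,
    Matrix.trace_mul_comm (mon x j ^ p * Y), ← Matrix.mul_assoc, ← pow_succ, ← pow_succ', sub_self,
    mul_zero]

/-! ### Anti-triangular matrices and the Casimirs -/

theorem belowAnti_iff {a b : Fin k} : BelowAnti a b ↔ Fin.rev a < b := by
  rw [BelowAnti, Fin.lt_def, Fin.val_rev]
  omega

theorem belowAnti_iff' {a b : Fin k} : BelowAnti a b ↔ Fin.rev b < a := by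
  rw [BelowAnti, Fin.lt_def, Fin.val_rev]
  omega

/-- Matrices that vanish strictly below the main anti-diagonal. -/
def AntiTriangular (B : Matrix (Fin k) (Fin k) ℂ) : Prop :=
  ∀ a b, BelowAnti a b → B a b = 0

/-- Reversing the columns gives an upper triangular matrix with the anti-diagonal on its diagonal.
-/
theorem AntiTriangular.det_ne_zero_iff {B : Matrix (Fin k) (Fin k) ℂ} (hB : AntiTriangular B) :
    B.det ≠ 0 ↔ ∀ a, B a (Fin.rev a) ≠ 0 := by
  have h := Matrix.det_permute' Fin.revPerm B
  rw [Matrix.det_of_isUpperTriangular (M := B.submatrix id Fin.revPerm)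
    (fun a b hab => hB _ _ (belowAnti_iff'.2 (by simpa using hab)))] at h
  have hs : ((Equiv.Perm.sign (Fin.revPerm : Equiv.Perm (Fin k)) : ℤ) : ℂ) ≠ 0 := by
    rcases Int.units_eq_one_or (Equiv.Perm.sign (Fin.revPerm : Equiv.Perm (Fin k))) with e | e <;>
      simp [e]
  have : B.det ≠ 0 ↔ ∏ i, B.submatrix id Fin.revPerm i i ≠ 0 := by
    rw [h]
    simp [hs]
  rw [this, Finset.prod_ne_zero_iff]
  simp

/-- On and below the anti-diagonal only `t = b` contributes: for `t < b` the weight of the lower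
part is zero, and for `t > b` the position `(a, t)` is below the anti-diagonal. -/
theorem AntiTriangular.mul_lowerPart_apply {B : Matrix (Fin k) (Fin k) ℂ} (hB : AntiTriangular B)
    (D : Matrix (Fin k) (Fin k) ℂ) {a b : Fin k} (h : Fin.rev a ≤ b) :
    (B * lowerPart D) a b = B a b * D b b := by
  rw [Matrix.mul_apply, Finset.sum_eq_single b]
  · simp [theta_self]
  · intro t _ ht
    rcases lt_or_gt_of_ne ht with h' | h'
    · simp [theta_of_lt h']
    · rw [hB a t (belowAnti_iff.2 (h.trans_lt h')), zero_mul]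
  · simp

theorem AntiTriangular.upperPart_mul_apply {B : Matrix (Fin k) (Fin k) ℂ} (hB : AntiTriangular B)
    (D : Matrix (Fin k) (Fin k) ℂ) {a b : Fin k} (h : Fin.rev b ≤ a) :
    (upperPart D * B) a b = D a a * B a b := by
  rw [Matrix.mul_apply, Finset.sum_eq_single a]
  · simp [theta_self]
  · intro t _ ht
    rcases lt_or_gt_of_ne ht with h' | h'
    · simp [theta_of_lt h']
    · rw [hB t b (belowAnti_iff'.2 (h.trans_lt h')), mul_zero]
  · simp

theorem det_boundary (x : Phase s k) : (boundary x).det = ∏ j, (mon x j).det := by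
  rw [boundary, ← Matrix.coe_detMonoidHom, map_list_prod, List.map_ofFn, List.prod_ofFn]
  rfl

theorem antiTriangular_boundary {x : Phase s k} (hx : x ∈ restrictedPhase s k) :
    AntiTriangular (boundary x) := hx.2

theorem det_boundary_ne_zero {x : Phase s k} (hx : x ∈ restrictedPhase s k) :
    (boundary x).det ≠ 0 := by
  rw [det_boundary]
  exact Finset.prod_ne_zero_iff.2 fun j _ => hx.1 j

theorem boundary_antidiagonal_ne_zero {x : Phase s k} (hx : x ∈ restrictedPhase s k) (a : Fin k) :
    boundary x a (Fin.rev a) ≠ 0 :=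
  (antiTriangular_boundary hx).det_ne_zero_iff.1 (det_boundary_ne_zero hx) a

theorem boundary_antidiagonal_ne_zero' {x : Phase s k} (hx : x ∈ restrictedPhase s k)
    (a : Fin k) : boundary x (Fin.rev a) a ≠ 0 := by
  simpa using boundary_antidiagonal_ne_zero hx (Fin.rev a)

theorem fderiv_boundary_sharp_of_belowAnti {x : Phase s k} (hx : x ∈ restrictedPhase s k)
    (α : Phase s k →L[ℂ] ℂ) {a b : Fin k} (h : BelowAnti a b) :
    fderiv ℂ (fun y : Phase s k => boundary y a b) x (sharp x α) = 0 := by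
  change entrywiseDeriv boundary x (sharp x α) a b = 0
  have hB := antiTriangular_boundary hx
  rw [entrywiseDeriv_boundary_sharp, Matrix.add_apply,
    hB.mul_lowerPart_apply _ (belowAnti_iff.1 h).le,
    hB.upperPart_mul_apply _ (belowAnti_iff'.1 h).le, hB a b h, zero_mul, mul_zero, add_zero]

/-- The logarithmic derivative is symmetric in `a` and `rev a`, so the quotient of the two mirror
entries is preserved. -/
theorem fderiv_boundary_sharp_antidiagonal {x : Phase s k} (hx : x ∈ restrictedPhase s k)
    (α : Phase s k →L[ℂ] ℂ) {a b : Fin k} (h : b = Fin.rev a) :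
    fderiv ℂ (fun y : Phase s k => boundary y a b) x (sharp x α) =
      boundary x a b * ((∑ j, gradComm x α j) a a + (∑ j, gradComm x α j) b b) := by
  subst h
  change entrywiseDeriv boundary x (sharp x α) a _ = _
  have hB := antiTriangular_boundary hx
  rw [entrywiseDeriv_boundary_sharp, Matrix.add_apply,
    hB.mul_lowerPart_apply _ le_rfl, hB.upperPart_mul_apply _ (by simp)]
  ring

theorem contDiffAt_ratioFun {x : Phase s k} (hx : x ∈ restrictedPhase s k) (i : Fin (k / 2)) :
    ContDiffAt ℂ 1 (ratioFun i) x :=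
  (entrywiseSmooth_boundary _ _).contDiffAt.div (entrywiseSmooth_boundary _ _).contDiffAt
    (boundary_antidiagonal_ne_zero' hx _)

theorem contDiffAt_casimirFun {x : Phase s k} (hx : x ∈ restrictedPhase s k)
    (i : (Fin s × Fin k) ⊕ Fin (k / 2)) : ContDiffAt ℂ 1 (casimirFun i) x := by
  rcases i with ⟨j, p⟩ | i
  · exact (((entrywiseSmooth_mon j).pow _).trace).contDiffAt
  · exact contDiffAt_ratioFun hx i

theorem fderiv_ratioFun {x : Phase s k} (hx : x ∈ restrictedPhase s k) (i : Fin (k / 2))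
    (v : Phase s k) :
    fderiv ℂ (ratioFun i) x v =
      entrywiseDeriv boundary x v (halfIndex i) (Fin.rev (halfIndex i))
          / boundary x (Fin.rev (halfIndex i)) (halfIndex i)
        - boundary x (halfIndex i) (Fin.rev (halfIndex i))
          * entrywiseDeriv boundary x v (Fin.rev (halfIndex i)) (halfIndex i)
          / boundary x (Fin.rev (halfIndex i)) (halfIndex i) ^ 2 := by
  have h0 := boundary_antidiagonal_ne_zero' hx (halfIndex i)
  have h := (entrywiseSmooth_boundary.differentiableAt
    (halfIndex i) (Fin.rev (halfIndex i)) x).hasFDerivAt.mul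
    ((hasDerivAt_inv h0).comp_hasFDerivAt x (entrywiseSmooth_boundary.differentiableAt
      (Fin.rev (halfIndex i)) (halfIndex i) x).hasFDerivAt)
  have e : fderiv ℂ (ratioFun i) x = _ := HasFDerivAt.fderiv h
  rw [e]
  simp only [add_apply, smul_apply, smul_eq_mul,
    entrywiseDeriv, Matrix.of_apply, Function.comp_apply]
  field_simp
  ring

theorem fderiv_casimirFun_sharp {x : Phase s k} (hx : x ∈ restrictedPhase s k)
    (i : (Fin s × Fin k) ⊕ Fin (k / 2)) (α : Phase s k →L[ℂ] ℂ) :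
    fderiv ℂ (casimirFun i) x (sharp x α) = 0 := by
  rcases i with ⟨j, p⟩ | i
  · exact fderiv_traceFun_of_commutator j p x _ _ (mon_sharp_eq_commutator x α j)
  · have h0 := boundary_antidiagonal_ne_zero' hx (halfIndex i)
    change fderiv ℂ (ratioFun i) x (sharp x α) = 0
    rw [fderiv_ratioFun hx]
    change fderiv ℂ (fun y : Phase s k => boundary y _ _) x (sharp x α) / _
      - _ * fderiv ℂ (fun y : Phase s k => boundary y _ _) x (sharp x α) / _ = 0
    rw [fderiv_boundary_sharp_antidiagonal hx α rfl,
      fderiv_boundary_sharp_antidiagonal hx α (by simp : halfIndex i = _)]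
    field_simp
    ring

theorem isCasimir_of_apply_sharp {f : Phase s k → ℂ}
    (hd : ∀ x ∈ restrictedPhase s k, DifferentiableAt ℂ f x)
    (h : ∀ x ∈ restrictedPhase s k, ∀ α, fderiv ℂ f x (sharp x α) = 0) : IsCasimir f :=
  fun x hx => ⟨hd x hx, fun g _ => by rw [poissonBracket_eq_apply_sharp, h x hx, neg_zero]⟩

theorem isCasimir_boundary {a b : Fin k} (h : BelowAnti a b) :
    IsCasimir (fun x : Phase s k => boundary x a b) :=
  isCasimir_of_apply_sharp (fun x _ => entrywiseSmooth_boundary.differentiableAt a b x)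
    fun _ hx α => fderiv_boundary_sharp_of_belowAnti hx α h

theorem isCasimir_casimirFun (i : (Fin s × Fin k) ⊕ Fin (k / 2)) :
    IsCasimir (casimirFun (s := s) i) :=
  isCasimir_of_apply_sharp (fun _ hx => (contDiffAt_casimirFun hx i).differentiableAt one_ne_zero)
    fun _ hx α => fderiv_casimirFun_sharp hx i α

/-! ### Cyclic vectors and the upper bound for the kernel -/

/-- The matrix with columns `v, M v, …, M ^ (k - 1) v`. -/
def krylov (M : Matrix (Fin k) (Fin k) ℂ) (v : Fin k → ℂ) : Matrix (Fin k) (Fin k) ℂ :=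
  Matrix.of fun a p => (M ^ (p : ℕ)).mulVec v a

theorem eq_zero_of_commute_of_mulVec_eq_zero {M Z : Matrix (Fin k) (Fin k) ℂ} {v : Fin k → ℂ}
    (hv : (krylov M v).det ≠ 0) (hc : Commute Z M) (hZ : Z.mulVec v = 0) : Z = 0 := by
  have h : Z * krylov M v = 0 := by
    ext a p
    have : (Z * krylov M v) a p = Z.mulVec ((M ^ (p : ℕ)).mulVec v) a := rfl
    rw [this, Matrix.mulVec_mulVec, (hc.pow_right p).eq, ← Matrix.mulVec_mulVec, hZ,
      Matrix.mulVec_zero]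
    rfl
  have hu : IsUnit (krylov M v).det := isUnit_iff_ne_zero.2 hv
  rw [← Matrix.mul_nonsing_inv_cancel_right (A := krylov M v) Z hu, h, zero_mul]

theorem eq_zero_of_sum_smul_pow_eq_zero {M : Matrix (Fin k) (Fin k) ℂ} {v : Fin k → ℂ}
    (hv : (krylov M v).det ≠ 0) {c : Fin k → ℂ} (hc : ∑ p, c p • M ^ (p : ℕ) = 0) : c = 0 := by
  refine Matrix.eq_zero_of_mulVec_eq_zero hv ?_
  have h : (∑ p, c p • M ^ (p : ℕ)).mulVec v = 0 := by rw [hc, Matrix.zero_mulVec]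
  rw [← h, Matrix.sum_mulVec]
  ext a
  simp only [Matrix.mulVec_eq_sum, Finset.sum_apply, Pi.smul_apply, krylov, Finset.mul_sum,
    Matrix.transpose_apply, Matrix.of_apply, op_smul_eq_smul, smul_eq_mul, Matrix.smul_apply]
  exact Finset.sum_congr rfl fun _ _ => Finset.sum_congr rfl fun _ _ => by ring

instance (a b : Fin k) : Decidable (BelowAnti a b) :=
  inferInstanceAs (Decidable (k + 2 ≤ ((a : ℕ) + 1) + ((b : ℕ) + 1)))

/-- Labels of the Casimirs, followed by the labels of the equations of the restricted phase
space. -/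
abbrev ConstraintIndex (s k : ℕ) : Type :=
  ((Fin s × Fin k) ⊕ Fin (k / 2)) ⊕ {p : Fin k × Fin k // BelowAnti p.1 p.2}

/-- The Casimirs, followed by the functions that define the restricted phase space. -/
def constraintFun : ConstraintIndex s k → Phase s k → ℂ
  | Sum.inl i => casimirFun i
  | Sum.inr p => fun x => boundary x p.1.1 p.1.2

theorem gradComm_add (x : Phase s k) (α β : Phase s k →L[ℂ] ℂ) (j : Fin s) :
    gradComm x (α + β) j = gradComm x α j + gradComm x β j := by
  simp only [gradComm, grad_add, mul_add, add_mul]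
  abel

theorem gradComm_smul (x : Phase s k) (r : ℂ) (α : Phase s k →L[ℂ] ℂ) (j : Fin s) :
    gradComm x (r • α) j = r • gradComm x α j := by
  simp only [gradComm, grad_smul, smul_sub, mul_smul_comm, smul_mul_assoc]

/-- Linear coordinates on covectors which are injective on the kernel of the Poisson tensor at
points where `v` is a cyclic vector of all matrices. -/
def kernelCoord (x : Phase s k) (v : Fin k → ℂ) :
    (Phase s k →L[ℂ] ℂ) →ₗ[ℂ] (ConstraintIndex s k → ℂ) where
  toFun α i := match i with
    | Sum.inl (Sum.inl ja) => (grad α ja.1).mulVec v ja.2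
    | Sum.inl (Sum.inr i) => (∑ j, gradComm x α j) (halfIndex i) (halfIndex i)
    | Sum.inr p => (∑ j, gradComm x α j) p.1.1 (Fin.rev p.1.2)
  map_add' α β := by
    funext i
    rcases i with (⟨j, a⟩ | i) | p
    · simp [grad_add, Matrix.add_mulVec]
    · simp [gradComm_add, Finset.sum_add_distrib]
    · simp [gradComm_add, Finset.sum_add_distrib]
  map_smul' r α := by
    funext i
    rcases i with (⟨j, a⟩ | i) | p
    · simp [grad_smul, Matrix.smul_mulVec]
    · simp [gradComm_smul, ← Finset.smul_sum]
    · simp [gradComm_smul, ← Finset.smul_sum]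

theorem exists_halfIndex (a : Fin k) :
    (∃ i, halfIndex i = a) ∨ (∃ i, Fin.rev (halfIndex i) = a) ∨ Fin.rev a = a := by
  rcases lt_trichotomy ((a : ℕ) + a + 1) k with h | h | h
  · exact Or.inl ⟨⟨a, by omega⟩, rfl⟩
  · refine Or.inr (Or.inr (Fin.ext ?_))
    rw [Fin.val_rev]
    omega
  · refine Or.inr (Or.inl ⟨⟨Fin.rev a, ?_⟩, ?_⟩)
    · rw [Fin.val_rev]
      omega
    · have : halfIndex ⟨(Fin.rev a : Fin k), by rw [Fin.val_rev]; omega⟩ = Fin.rev a := rfl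
      rw [this, Fin.rev_rev]

/-- The equation `0 = B L(D) + U(D) B` pairs the diagonal entries of `D` as `D_{aa} = -D_{rev a, rev
a}`, so half of them control all. With the lower entries gone, `L(D) = 0`, and invertibility of `B`
gives `U(D) = 0`. -/
theorem sum_gradComm_eq_zero {x : Phase s k} (hx : x ∈ restrictedPhase s k)
    {α : Phase s k →L[ℂ] ℂ} (hα : sharp x α = 0)
    (hlow : ∀ a b, b < a → (∑ j, gradComm x α j) a b = 0)
    (hdiag : ∀ i, (∑ j, gradComm x α j) (halfIndex i) (halfIndex i) = 0) :
    ∑ j, gradComm x α j = 0 := by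
  have hB := antiTriangular_boundary hx
  have h0 := entrywiseDeriv_boundary_sharp x α
  have hs : ∀ a, (∑ j, gradComm x α j) a a
      + (∑ j, gradComm x α j) (Fin.rev a) (Fin.rev a) = 0 := by
    intro a
    have h := fderiv_boundary_sharp_antidiagonal hx α (rfl : Fin.rev a = Fin.rev a)
    rw [hα, map_zero, eq_comm] at h
    exact (mul_eq_zero.1 h).resolve_left (boundary_antidiagonal_ne_zero hx a)
  generalize ∑ j, gradComm x α j = D at *
  have hd : ∀ a, D a a = 0 := by
    intro a
    rcases exists_halfIndex a with ⟨i, rfl⟩ | ⟨i, rfl⟩ | h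
    · exact hdiag i
    -- The pairing transfers the vanishing to the other half; the remaining case is the middle index
    -- of odd `k`, where it reads `2 D_{aa} = 0`.
    · have := hs (halfIndex i)
      rwa [hdiag, zero_add] at this
    · have := hs a
      rw [h] at this
      exact self_eq_neg.1 (eq_neg_of_add_eq_zero_left this)
  have hL : lowerPart D = 0 := by
    ext a b
    rcases lt_trichotomy a b with h | h | h
    · simp [theta_of_lt h]
    · simp [h, hd]
    · simp [hlow a b h]
  have hz : entrywiseDeriv boundary x (sharp x α) = 0 := by
    ext a b
    simp [entrywiseDeriv, hα]
  rw [hz, hL, mul_zero, zero_add] at h0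
  have hu : IsUnit (boundary x).det := isUnit_iff_ne_zero.2 (det_boundary_ne_zero hx)
  have hU : upperPart D = 0 := by
    rw [← Matrix.mul_nonsing_inv_cancel_right (A := boundary x) (upperPart D) hu, ← h0, zero_mul]
  have := lowerPart_add_upperPart D
  rw [hL, hU, add_zero, eq_comm] at this
  exact (smul_eq_zero.1 this).resolve_left two_ne_zero

/-- Once `D = 0`, all gauge matrices vanish, hence so do their increments `2 C_j`. Each gradient
then commutes with `M_j` and kills its cyclic vector. -/
theorem eq_zero_of_kernelCoord_eq_zero {x : Phase s k} (hx : x ∈ restrictedPhase s k)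
    {v : Fin k → ℂ} (hv : ∀ j, (krylov (mon x j) v).det ≠ 0) {α : Phase s k →L[ℂ] ℂ}
    (hα : sharp x α = 0) (hc : kernelCoord x v α = 0) : α = 0 := by
  have hD : ∑ j, gradComm x α j = 0 := by
    refine sum_gradComm_eq_zero hx hα (fun a b h => ?_) fun i => ?_
    -- Reflecting the columns turns positions below the anti-diagonal into positions below the
    -- diagonal.
    · have := congrFun hc (Sum.inr ⟨(a, Fin.rev b), belowAnti_iff'.2 (by simpa using h)⟩)
      simpa [kernelCoord] using this
    · exact congrFun hc (Sum.inl (Sum.inr i))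
  have hg : ∀ i, i ≤ s → gauge x α i = 0 := by
    intro i
    induction i with
    | zero => intro _; rw [gauge_zero, hD]; ext; simp
    | succ i ih =>
      intro hi
      -- The vector vanishes and `Y_i = 0`, so `M_i Y_{i+1} = 0`, with `M_i` invertible.
      have h := mon_sharp x α ⟨i, hi⟩
      rw [hα, ih (by omega), zero_mul, sub_zero] at h
      have hu : IsUnit (mon x ⟨i, hi⟩).det := isUnit_iff_ne_zero.2 (hx.1 _)
      rw [← Matrix.nonsing_inv_mul_cancel_left (A := mon x ⟨i, hi⟩) (gauge x α (i + 1)) hu]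
      rw [← h]
      ext; simp [mon, Matrix.mul_apply]
  refine ext_grad fun j => ?_
  have h0 : grad (0 : Phase s k →L[ℂ] ℂ) j = 0 := by ext; simp [grad]
  rw [h0]
  have hj := gauge_succ x α j
  rw [hg _ (by omega), hg _ (by omega), zero_add, eq_comm] at hj
  have hcomm := sub_eq_zero.1 ((smul_eq_zero.1 hj).resolve_left two_ne_zero)
  refine eq_zero_of_commute_of_mulVec_eq_zero (hv j) hcomm.symm ?_
  funext a
  exact congrFun hc (Sum.inl (Sum.inl (j, a)))

theorem finrank_ker_sharp_le {x : Phase s k} (hx : x ∈ restrictedPhase s k)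
    {v : Fin k → ℂ} (hv : ∀ j, (krylov (mon x j) v).det ≠ 0) :
    Module.finrank ℂ (LinearMap.ker (sharp x)) ≤ Fintype.card (ConstraintIndex s k) := by
  rw [← Module.finrank_fintype_fun_eq_card (R := ℂ)]
  refine LinearMap.finrank_le_finrank_of_injective
    (f := (kernelCoord x v).domRestrict (LinearMap.ker (sharp x))) ?_
  rw [injective_iff_map_eq_zero]
  intro α h
  exact Subtype.ext (eq_zero_of_kernelCoord_eq_zero hx hv α.2 h)

/-! ### Independence of the Casimirs and the defining equations -/

/-- `B Γ` is upper triangular and `Γ B` is lower triangular, so their common value is diagonal. Its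
diagonal entries are the two summands in `hanti`, equal to and negative of each other, so `B Γ = 0`.
-/
theorem AntiTriangular.eq_zero_of_commute {B Γ : Matrix (Fin k) (Fin k) ℂ}
    (hB : AntiTriangular B) (hdet : B.det ≠ 0) (hΓ : ∀ a b, b < Fin.rev a → Γ a b = 0)
    (hanti : ∀ a, B a (Fin.rev a) * Γ (Fin.rev a) a + Γ a (Fin.rev a) * B (Fin.rev a) a = 0)
    (hcomm : B * Γ = Γ * B) : Γ = 0 := by
  have hl : ∀ a b, b < a → (B * Γ) a b = 0 := by
    intro a b h
    rw [Matrix.mul_apply]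
    refine Finset.sum_eq_zero fun t _ => ?_
    rcases lt_or_ge (Fin.rev a) t with h' | h'
    · rw [hB a t (belowAnti_iff.2 h'), zero_mul]
    · rw [hΓ t b (h.trans_le (Fin.le_rev_iff.1 h')), mul_zero]
  have hr : ∀ a b, a < b → (Γ * B) a b = 0 := by
    intro a b h
    rw [Matrix.mul_apply]
    refine Finset.sum_eq_zero fun t _ => ?_
    rcases lt_or_ge (Fin.rev b) t with h' | h'
    · rw [hB t b (belowAnti_iff'.2 h'), mul_zero]
    · rw [hΓ a t (h'.trans_lt (Fin.rev_lt_rev.2 h)), zero_mul]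
  have hd : ∀ a, (B * Γ) a a = 0 := by
    intro a
    have e1 : (B * Γ) a a = B a (Fin.rev a) * Γ (Fin.rev a) a := by
      rw [Matrix.mul_apply]
      refine Finset.sum_eq_single _ (fun t _ ht => ?_) (by simp)
      rcases lt_or_gt_of_ne ht with h' | h'
      · rw [hΓ t a (Fin.lt_rev_iff.1 h'), mul_zero]
      · rw [hB a t (belowAnti_iff.2 h'), zero_mul]
    have e2 : (Γ * B) a a = Γ a (Fin.rev a) * B (Fin.rev a) a := by
      rw [Matrix.mul_apply]
      refine Finset.sum_eq_single _ (fun t _ ht => ?_) (by simp)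
      rcases lt_or_gt_of_ne ht with h' | h'
      · rw [hΓ a t h', zero_mul]
      · rw [hB t a (belowAnti_iff'.2 h'), mul_zero]
    have := hanti a
    rw [← e1, ← e2, ← hcomm] at this
    exact self_eq_neg.1 (eq_neg_of_add_eq_zero_left this)
  have h0 : B * Γ = 0 := by
    ext a b
    rcases lt_trichotomy a b with h | h | h
    · rw [hcomm, hr a b h]; rfl
    · rw [h, hd]; rfl
    · rw [hl a b h]; rfl
  have hu : IsUnit B.det := isUnit_iff_ne_zero.2 hdet
  rw [← Matrix.nonsing_inv_mul_cancel_left (A := B) Γ hu, h0, mul_zero]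

theorem halfIndex_injective : Function.Injective (halfIndex (k := k)) :=
  Fin.castLE_injective (Nat.div_le_self k 2)

theorem halfIndex_ne_rev (i j : Fin (k / 2)) : halfIndex i ≠ Fin.rev (halfIndex j) := by
  intro h
  have h1 := congrArg Fin.val h
  rw [Fin.val_rev] at h1
  have h2 : ((halfIndex i : Fin k) : ℕ) = i := rfl
  have h3 : ((halfIndex j : Fin k) : ℕ) = j := rfl
  omega

/-- The gradient, with respect to the boundary matrix, of a linear combination of the ratios and of
the entries below the anti-diagonal. -/
def boundaryGrad (B : Matrix (Fin k) (Fin k) ℂ) (c : Fin (k / 2) → ℂ)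
    (e : {p : Fin k × Fin k // BelowAnti p.1 p.2} → ℂ) : Matrix (Fin k) (Fin k) ℂ :=
  ∑ i, c i • (Matrix.single (Fin.rev (halfIndex i)) (halfIndex i)
        (1 / B (Fin.rev (halfIndex i)) (halfIndex i))
      - Matrix.single (halfIndex i) (Fin.rev (halfIndex i))
        (B (halfIndex i) (Fin.rev (halfIndex i)) / B (Fin.rev (halfIndex i)) (halfIndex i) ^ 2))
    + ∑ p, e p • Matrix.single p.1.2 p.1.1 1

section BoundaryGrad

variable (B : Matrix (Fin k) (Fin k) ℂ) (c : Fin (k / 2) → ℂ)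
    (e : {p : Fin k × Fin k // BelowAnti p.1 p.2} → ℂ)

theorem trace_boundaryGrad_mul (Z : Matrix (Fin k) (Fin k) ℂ) :
    (boundaryGrad B c e * Z).trace =
      ∑ i, c i * (Z (halfIndex i) (Fin.rev (halfIndex i))
            / B (Fin.rev (halfIndex i)) (halfIndex i)
          - B (halfIndex i) (Fin.rev (halfIndex i)) * Z (Fin.rev (halfIndex i)) (halfIndex i)
            / B (Fin.rev (halfIndex i)) (halfIndex i) ^ 2)
        + ∑ p, e p * Z p.1.1 p.1.2 := by
  simp only [boundaryGrad, add_mul, Finset.sum_mul, Matrix.trace_add, Matrix.trace_sum,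
    smul_mul_assoc, Matrix.trace_smul, sub_mul, Matrix.trace_sub, Matrix.trace_single_mul,
    smul_eq_mul]
  congr 1
  · exact Finset.sum_congr rfl fun i _ => by ring
  · exact Finset.sum_congr rfl fun i _ => by ring

theorem boundaryGrad_apply (a b : Fin k) :
    boundaryGrad B c e a b =
      ∑ i, c i * ((if Fin.rev (halfIndex i) = a ∧ halfIndex i = b then
            1 / B (Fin.rev (halfIndex i)) (halfIndex i) else 0)
          - (if halfIndex i = a ∧ Fin.rev (halfIndex i) = b then
            B (halfIndex i) (Fin.rev (halfIndex i))
              / B (Fin.rev (halfIndex i)) (halfIndex i) ^ 2 else 0))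
        + ∑ p, e p * (if p.1.2 = a ∧ p.1.1 = b then 1 else 0) := by
  simp [boundaryGrad, Matrix.sum_apply, Matrix.single_apply]

theorem boundaryGrad_of_lt_rev {a b : Fin k} (h : b < Fin.rev a) : boundaryGrad B c e a b = 0 := by
  rw [boundaryGrad_apply, Finset.sum_eq_zero, Finset.sum_eq_zero, add_zero]
  · rintro ⟨p, hp⟩ _
    rw [if_neg, mul_zero]
    rintro ⟨rfl, rfl⟩
    exact (belowAnti_iff'.1 hp).asymm h
  · intro i _
    rw [if_neg, if_neg, sub_zero, mul_zero]
    · rintro ⟨rfl, rfl⟩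
      exact h.ne rfl
    · rintro ⟨rfl, rfl⟩
      simp at h

/-- This is Euler's relation: each ratio is homogeneous of degree zero in its two mirror entries. -/
theorem boundaryGrad_antidiagonal (hB : ∀ a, B a (Fin.rev a) ≠ 0) (a : Fin k) :
    B a (Fin.rev a) * boundaryGrad B c e (Fin.rev a) a
      + boundaryGrad B c e a (Fin.rev a) * B (Fin.rev a) a = 0 := by
  have hz : ∀ a b : Fin k, b = Fin.rev a →
      ∑ p : {p : Fin k × Fin k // BelowAnti p.1 p.2},
        e p * (if p.1.2 = a ∧ p.1.1 = b then 1 else 0) = 0 := by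
    rintro a b rfl
    refine Finset.sum_eq_zero ?_
    rintro ⟨p, hp⟩ _
    rw [if_neg, mul_zero]
    rintro ⟨rfl, h⟩
    exact (belowAnti_iff'.1 hp).ne h.symm
  rw [boundaryGrad_apply, boundaryGrad_apply, hz _ _ (by simp), hz _ _ rfl, add_zero, add_zero,
    Finset.mul_sum, Finset.sum_mul, ← Finset.sum_add_distrib]
  refine Finset.sum_eq_zero fun i _ => ?_
  have hi := hB (halfIndex i)
  have hi' : B (Fin.rev (halfIndex i)) (halfIndex i) ≠ 0 := by
    simpa using hB (Fin.rev (halfIndex i))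
  have hn := halfIndex_ne_rev i i
  by_cases h1 : halfIndex i = a
  · subst h1
    simp only [and_self, if_true, hn, hn.symm, if_false]
    field_simp
    ring
  · by_cases h2 : Fin.rev (halfIndex i) = a
    · subst h2
      simp only [Fin.rev_rev, and_self, if_true, hn, hn.symm, if_false]
      field_simp
      ring
    · have h3 : halfIndex i ≠ Fin.rev a := fun h => h2 (by rw [h, Fin.rev_rev])
      simp [h1, h2, h3]

theorem boundaryGrad_of_belowAnti (p : {p : Fin k × Fin k // BelowAnti p.1 p.2}) :
    boundaryGrad B c e p.1.2 p.1.1 = e p := by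
  have hp := belowAnti_iff'.1 p.2
  rw [boundaryGrad_apply, Finset.sum_eq_zero, zero_add, Finset.sum_eq_single p]
  · simp
  · intro q _ hq
    rw [if_neg, mul_zero]
    rintro ⟨h1, h2⟩
    exact hq (Subtype.ext (Prod.ext h2 h1))
  · simp
  · intro i _
    rw [if_neg, if_neg, sub_zero, mul_zero]
    · rintro ⟨h1, h2⟩
      rw [← h1, ← h2] at hp
      exact hp.ne rfl
    · rintro ⟨h1, h2⟩
      rw [← h1, ← h2] at hp
      simp at hp

theorem boundaryGrad_rev_halfIndex (he : e = 0) (i : Fin (k / 2)) :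
    boundaryGrad B c e (Fin.rev (halfIndex i)) (halfIndex i) =
      c i * (1 / B (Fin.rev (halfIndex i)) (halfIndex i)) := by
  subst he
  rw [boundaryGrad_apply, Finset.sum_eq_single i]
  · simp [halfIndex_ne_rev]
  · intro j _ hj
    have : halfIndex j ≠ halfIndex i := fun h => hj (halfIndex_injective h)
    simp [this, halfIndex_ne_rev]
  · simp

end BoundaryGrad

/-- A vanishing combination is tested on two kinds of vectors. Simultaneous infinitesimal
conjugations kill the trace terms and force `Γ` to commute with the boundary matrix, hence `Γ = 0`.
Variations of a single matrix `M_j` then give a linear relation among its powers below the `k`-th,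
which cyclicity excludes. -/
theorem linearIndependent_fderiv_constraintFun {x : Phase s k} (hx : x ∈ restrictedPhase s k)
    {v : Fin k → ℂ} (hv : ∀ j, (krylov (mon x j) v).det ≠ 0) :
    LinearIndependent ℂ fun i : ConstraintIndex s k => fderiv ℂ (constraintFun i) x := by
  rw [Fintype.linearIndependent_iff]
  intro g hg
  have hw : ∀ w, ∑ i, g i * fderiv ℂ (constraintFun i) x w = 0 := by
    intro w
    have := congrArg (fun L : Phase s k →L[ℂ] ℂ => L w) hg
    simpa using this
  set Γ := boundaryGrad (boundary x) (fun i => g (Sum.inl (Sum.inr i))) fun p => g (Sum.inr p)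
    with hΓ
  have hw' : ∀ w, ∑ jp, g (Sum.inl (Sum.inl jp)) * fderiv ℂ (traceFun jp.1 ((jp.2 : ℕ) + 1)) x w
      + (Γ * entrywiseDeriv boundary x w).trace = 0 := by
    intro w
    rw [← hw w, Fintype.sum_sum_type, Fintype.sum_sum_type, add_assoc, hΓ, trace_boundaryGrad_mul]
    congr 2
    refine Finset.sum_congr rfl fun i _ => ?_
    rw [← fderiv_ratioFun hx]
    rfl
  have hcomm : boundary x * Γ = Γ * boundary x := by
    rw [Matrix.ext_iff_trace_mul_right]
    intro Y
    -- Taking the same `Y` at every vertex moves the boundary matrix by `[B, Y]`.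
    let w : Phase s k := fun c => (mon x c.1 * Y - Y * mon x c.1) c.2.1 c.2.2
    have hmw : ∀ j, mon w j = mon x j * Y - Y * mon x j := fun _ => rfl
    have h := hw' w
    rw [Finset.sum_eq_zero, zero_add, entrywiseDeriv_boundary_of_gauge x w (fun _ => Y) hmw,
      mul_sub, Matrix.trace_sub, sub_eq_zero] at h
    · rw [Matrix.mul_assoc Γ, h, Matrix.mul_assoc, Matrix.trace_mul_comm, Matrix.mul_assoc]
    · intro jp _
      rw [fderiv_traceFun_of_commutator _ _ x w Y (hmw _), mul_zero]
  have hB := antiTriangular_boundary hx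
  have hΓ0 : Γ = 0 := hB.eq_zero_of_commute (det_boundary_ne_zero hx)
    (fun a b h => boundaryGrad_of_lt_rev _ _ _ h)
    (boundaryGrad_antidiagonal _ _ _ (boundary_antidiagonal_ne_zero hx)) hcomm
  have he : (fun p => g (Sum.inr p)) = 0 := by
    funext p
    have := boundaryGrad_of_belowAnti (boundary x) (fun i => g (Sum.inl (Sum.inr i)))
      (fun p => g (Sum.inr p)) p
    rw [← this, ← hΓ, hΓ0]
    rfl
  have hc : ∀ i, g (Sum.inl (Sum.inr i)) = 0 := by
    intro i
    have := boundaryGrad_rev_halfIndex (boundary x) (fun i => g (Sum.inl (Sum.inr i)))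
      (fun p => g (Sum.inr p)) he i
    rw [← hΓ, hΓ0, Matrix.zero_apply, eq_comm] at this
    exact (mul_eq_zero.1 this).resolve_right
      (one_div_ne_zero (boundary_antidiagonal_ne_zero' hx _))
  have ht : ∀ j p, g (Sum.inl (Sum.inl (j, p))) = 0 := by
    intro j
    have hsum : ∑ p : Fin k, (g (Sum.inl (Sum.inl (j, p))) * ((p : ℕ) + 1)) •
        mon x j ^ (p : ℕ) = 0 := by
      rw [Matrix.ext_iff_trace_mul_right]
      intro Y
      let w : Phase s k := fun c => if c.1 = j then Y c.2.1 c.2.2 else 0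
      have hmw : ∀ i, mon w i = if i = j then Y else 0 := by
        intro i
        ext a b
        by_cases h : i = j <;> simp [mon, w, h]
      have h := hw' w
      rw [hΓ0, zero_mul, Matrix.trace_zero, add_zero, Fintype.sum_prod_type,
        Finset.sum_eq_single j] at h
      · rw [zero_mul, Matrix.trace_zero, ← h, Finset.sum_mul, Matrix.trace_sum]
        refine Finset.sum_congr rfl fun p _ => ?_
        rw [fderiv_traceFun, hmw, if_pos rfl, smul_mul_assoc, Matrix.trace_smul, smul_eq_mul,
          mul_assoc]
      · intro i _ hi
        refine Finset.sum_eq_zero fun p _ => ?_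
        rw [fderiv_traceFun, hmw, if_neg hi, mul_zero, Matrix.trace_zero, mul_zero, mul_zero]
      · simp
    intro p
    have h := congrFun (eq_zero_of_sum_smul_pow_eq_zero (hv j) hsum) p
    exact (mul_eq_zero.1 h).resolve_right (by exact_mod_cast Nat.succ_ne_zero p)
  rintro ((⟨j, p⟩ | i) | p)
  · exact ht j p
  · exact hc i
  · exact congrFun he p

/-! ### The dimension count and completeness -/

theorem card_belowAnti (k : ℕ) :
    Fintype.card {p : Fin k × Fin k // BelowAnti p.1 p.2} = k * (k - 1) / 2 := by
  rw [Fintype.card_subtype, Finset.card_filter, Fintype.sum_prod_type, ← Finset.sum_range_id,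
    ← Fin.sum_univ_eq_sum_range]
  refine Finset.sum_congr rfl fun a _ => ?_
  rw [← Finset.card_filter]
  have : (Finset.univ.filter fun b => BelowAnti a b) = Finset.Ioi (Fin.rev a) := by
    ext b
    simp [belowAnti_iff]
  rw [this, Fin.card_Ioi, Fin.val_rev]
  omega

/-- The second alternative covers truncated subtraction. It is excluded later by rank-nullity, since
the kernel of `sharp x` has the size of `ConstraintIndex s k`. -/
theorem finrank_covectors (s k : ℕ) :
    Module.finrank ℂ (Phase s k →L[ℂ] ℂ) = Fintype.card (ConstraintIndex s k)
      + (s * (k * (k - 1)) - k * (k - 1) / 2 - k / 2) ∨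
    Module.finrank ℂ (Phase s k →L[ℂ] ℂ) < Fintype.card (ConstraintIndex s k) := by
  have e : Module.finrank ℂ (Phase s k →L[ℂ] ℂ) = s * (k * k) := by
    rw [← LinearEquiv.finrank_eq (LinearMap.toContinuousLinearMap (𝕜 := ℂ) (E := Phase s k)
      (F' := ℂ)), Subspace.dual_finrank_eq]
    simp
  have h : s * (k * k) = s * k + s * (k * (k - 1)) := by
    rcases k with _ | k
    · simp
    · simp only [Nat.add_sub_cancel]
      ring
  rw [e, h]
  simp only [Fintype.card_sum, Fintype.card_prod, Fintype.card_fin, card_belowAnti]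
  omega

theorem sharp_fderiv_constraintFun {x : Phase s k} (hx : x ∈ restrictedPhase s k)
    (i : ConstraintIndex s k) (α : Phase s k →L[ℂ] ℂ) :
    fderiv ℂ (constraintFun i) x (sharp x α) = 0 := by
  rcases i with i | p
  · exact fderiv_casimirFun_sharp hx i α
  · exact fderiv_boundary_sharp_of_belowAnti hx α p.2

theorem span_fderiv_constraintFun {x : Phase s k} (hx : x ∈ restrictedPhase s k)
    {v : Fin k → ℂ} (hv : ∀ j, (krylov (mon x j) v).det ≠ 0) :
    Submodule.span ℂ (Set.range fun i : ConstraintIndex s k => fderiv ℂ (constraintFun i) x) =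
      LinearMap.ker (sharp x) := by
  refine Submodule.eq_of_le_of_finrank_le ?_ ?_
  · rw [Submodule.span_le]
    rintro _ ⟨i, rfl⟩
    exact sharp_eq_zero_of_apply_sharp (sharp_fderiv_constraintFun hx i)
  · rw [finrank_span_eq_card (linearIndependent_fderiv_constraintFun hx hv)]
    exact finrank_ker_sharp_le hx hv

theorem finrank_ker_sharp {x : Phase s k} (hx : x ∈ restrictedPhase s k)
    {v : Fin k → ℂ} (hv : ∀ j, (krylov (mon x j) v).det ≠ 0) :
    Module.finrank ℂ (LinearMap.ker (sharp x)) = Fintype.card (ConstraintIndex s k) := by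
  rw [← span_fderiv_constraintFun hx hv,
    finrank_span_eq_card (linearIndependent_fderiv_constraintFun hx hv)]

theorem finrank_range_sharp {x : Phase s k} (hx : x ∈ restrictedPhase s k)
    {v : Fin k → ℂ} (hv : ∀ j, (krylov (mon x j) v).det ≠ 0) :
    Module.finrank ℂ (LinearMap.range (sharp x)) = maxLeafDim s k := by
  have h := LinearMap.finrank_range_add_finrank_ker (sharp x)
  rw [finrank_ker_sharp hx hv] at h
  have := finrank_covectors s k
  rw [maxLeafDim]
  omega

/-- A vector outside the range is separated from it by a covector, which lies in the kernel by
antisymmetry and is therefore a combination of the constraint differentials. -/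
theorem mem_range_sharp_iff {x : Phase s k} (hx : x ∈ restrictedPhase s k)
    {v : Fin k → ℂ} (hv : ∀ j, (krylov (mon x j) v).det ≠ 0) {w : Phase s k} :
    w ∈ LinearMap.range (sharp x) ↔
      ∀ i : ConstraintIndex s k, fderiv ℂ (constraintFun i) x w = 0 := by
  constructor
  · rintro ⟨α, rfl⟩ i
    exact sharp_fderiv_constraintFun hx i α
  · intro h
    by_contra hw
    obtain ⟨f, hf, hle⟩ := Submodule.exists_le_ker_of_notMem hw
    have hk : LinearMap.toContinuousLinearMap f ∈ LinearMap.ker (sharp x) :=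
      sharp_eq_zero_of_apply_sharp fun β => hle ⟨β, rfl⟩
    rw [← span_fderiv_constraintFun hx hv] at hk
    refine hf ?_
    change LinearMap.toContinuousLinearMap f w = 0
    generalize LinearMap.toContinuousLinearMap f = β at hk ⊢
    induction hk using Submodule.span_induction with
    | mem α hα => obtain ⟨i, rfl⟩ := hα; exact h i
    | zero => rfl
    | add α β _ _ h1 h2 => simp [h1, h2]
    | smul r α _ h1 => simp [h1]

/-- Covectors vanishing on the tangent space are combinations of the differentials of the defining
equations. Independence of the whole family therefore leaves the Casimir part independent after
restriction. -/
theorem casimirsCompleteAt_of_krylov {x : Phase s k} (hx : x ∈ restrictedPhase s k)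
    {v : Fin k → ℂ} (hv : ∀ j, (krylov (mon x j) v).det ≠ 0) : CasimirsCompleteAt x := by
  have hli := linearIndependent_fderiv_constraintFun hx hv
  obtain ⟨h1, -, hdisj⟩ := linearIndependent_sum.1 hli
  have hspan := span_fderiv_constraintFun hx hv
  have hker : LinearMap.ker (restrictCovector x) ≤ Submodule.span ℂ (Set.range
      ((fun i : ConstraintIndex s k => fderiv ℂ (constraintFun i) x) ∘ Sum.inr)) := by
    intro α hα
    have hα' : α.toLinearMap ∈ Submodule.span ℂ (Set.range
        fun p : {p : Fin k × Fin k // BelowAnti p.1 p.2} =>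
          (fderiv ℂ (fun y : Phase s k => boundary y p.1.1 p.1.2) x).toLinearMap) := by
      refine mem_span_of_iInf_ker_le_ker fun w hw => ?_
      rw [Submodule.mem_iInf] at hw
      exact LinearMap.congr_fun hα ⟨w, fun a b hab => hw ⟨(a, b), hab⟩⟩
    have := Submodule.mem_map_of_mem
      (f := (LinearMap.toContinuousLinearMap (𝕜 := ℂ) (E := Phase s k) (F' := ℂ)).toLinearMap) hα'
    rw [Submodule.map_span, ← Set.range_comp] at this
    exact this
  refine ⟨h1.map (f := restrictCovector x) (hdisj.mono_right hker), ?_⟩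
  rw [← hspan, Submodule.map_span, ← Set.range_comp]
  refine le_antisymm (Submodule.span_mono ?_) (Submodule.span_le.2 ?_)
  · rintro _ ⟨i, rfl⟩
    exact ⟨Sum.inl i, rfl⟩
  · rintro _ ⟨i | p, rfl⟩
    · exact Submodule.subset_span ⟨i, rfl⟩
    · have : restrictCovector x (fderiv ℂ (constraintFun (Sum.inr p)) x) = 0 := by
        ext w
        exact w.2 _ _ p.2
      change restrictCovector x (fderiv ℂ (constraintFun (Sum.inr p)) x) ∈ _
      rw [this]
      exact Submodule.zero_mem _

/-! ### Continuity and semicontinuity of the rank -/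

theorem continuous_mon (j : Fin s) : Continuous fun y : Phase s k => mon y j :=
  continuous_matrix fun a b => continuous_apply (j, a, b)

theorem continuous_krylov (v : Fin k → ℂ) :
    Continuous fun M : Matrix (Fin k) (Fin k) ℂ => krylov M v :=
  continuous_matrix fun a p =>
    (continuous_apply a).comp ((continuous_pow (p : ℕ)).matrix_mulVec continuous_const)

theorem continuous_sameBracket (j : Fin s) (a b c d : Fin k) :
    Continuous fun y : Phase s k => sameBracket (mon y j) a b c d := by
  have h := fun a b => (continuous_mon (k := k) j).matrix_elem a b
  unfold sameBracket
  split_ifs <;> fun_prop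

theorem continuous_crossBracket (i j : Fin s) (a b c d : Fin k) :
    Continuous fun y : Phase s k => crossBracket (mon y i) (mon y j) a b c d := by
  have h := fun a b => (continuous_mon (k := k) i).matrix_elem a b
  have h' := fun a b => (continuous_mon (k := k) j).matrix_elem a b
  unfold crossBracket
  split_ifs <;> fun_prop

theorem continuous_sharp_apply (α : Phase s k →L[ℂ] ℂ) :
    Continuous fun y : Phase s k => sharp y α := by
  refine continuous_pi fun c' => continuous_finsetSum _ fun c _ => continuous_const.mul ?_
  unfold coordBracket
  split_ifs
  · exact continuous_sameBracket _ _ _ _ _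
  · exact continuous_crossBracket _ _ _ _ _ _
  · exact (continuous_crossBracket _ _ _ _ _ _).neg

theorem LeafHasDim.finrank_range_sharp_eq {x : Phase s k} {d : ℕ} (h : LeafHasDim x d) :
    Module.finrank ℂ (LinearMap.range (sharp x)) = d := by
  obtain ⟨U, φ, -, h0, hx, -, -, hU⟩ := h
  obtain ⟨-, hinj, hr⟩ := hU 0 h0
  rw [hx] at hr
  have : LinearMap.range (sharp x) = LinearMap.range (fderiv ℂ φ 0).toLinearMap :=
    SetLike.coe_injective hr.symm
  rw [this, LinearMap.finrank_range_of_inj hinj, Module.finrank_fin_fun]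

/-- Fixed covectors whose Hamiltonian vectors are independent at `x` keep this property nearby, so
the rank is lower semicontinuous. -/
theorem finrank_range_sharp_le_of_mem_closure {x : Phase s k} {S : Set (Phase s k)} {d : ℕ}
    (hS : ∀ y ∈ S, Module.finrank ℂ (LinearMap.range (sharp y)) ≤ d) (hx : x ∈ closure S) :
    Module.finrank ℂ (LinearMap.range (sharp x)) ≤ d := by
  let b := Module.finBasis ℂ (LinearMap.range (sharp x))
  choose α hα using fun i => (b i).2
  have hli : LinearIndependent ℂ fun i => sharp x (α i) := by
    simp only [hα]
    exact b.linearIndependent.map' (LinearMap.range (sharp x)).subtype (Submodule.ker_subtype _)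
  have hopen := (isOpen_setOfPred_linearIndependent (𝕜 := ℂ) (E := Phase s k)).preimage
    (continuous_pi fun i => continuous_sharp_apply (α i))
  obtain ⟨y, hy, hyS⟩ := mem_closure_iff.1 hx _ hopen hli
  refine le_trans ?_ (hS y hyS)
  have hy' : LinearIndependent ℂ fun i => (⟨sharp y (α i), α i, rfl⟩ : LinearMap.range (sharp y)) :=
    LinearIndependent.of_comp (LinearMap.range (sharp y)).subtype hy
  simpa using hy'.fintype_card_le_finrank

/-! ### Charts of the leaves -/

theorem contDiffAt_constraintFun {x : Phase s k} (hx : x ∈ restrictedPhase s k)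
    (i : ConstraintIndex s k) : ContDiffAt ℂ 1 (constraintFun i) x := by
  rcases i with i | p
  · exact contDiffAt_casimirFun hx i
  · exact (entrywiseSmooth_boundary _ _).contDiffAt

/-- Linear coordinates on the tangent space of the leaf at a point where `v` is a cyclic vector of
all matrices. -/
theorem exists_leaf_coordinates {x : Phase s k} (hx : x ∈ restrictedPhase s k)
    {v : Fin k → ℂ} (hv : ∀ j, (krylov (mon x j) v).det ≠ 0) :
    ∃ (Q : Phase s k →L[ℂ] (Fin (maxLeafDim s k) → ℂ))
      (V : (Fin (maxLeafDim s k) → ℂ) →ₗ[ℂ] (Phase s k →L[ℂ] ℂ))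
      (Ψ : Phase s k ≃L[ℂ] (ConstraintIndex s k → ℂ) × (Fin (maxLeafDim s k) → ℂ)),
      (∀ u, Q (sharp x (V u)) = u) ∧
      ∀ w, Ψ w = (fun i => fderiv ℂ (constraintFun i) x w, Q w) := by
  let K := LinearMap.range (sharp x)
  have hK : Module.finrank ℂ K = Module.finrank ℂ (Fin (maxLeafDim s k) → ℂ) := by
    rw [Module.finrank_fin_fun]
    exact finrank_range_sharp hx hv
  let e : K ≃ₗ[ℂ] (Fin (maxLeafDim s k) → ℂ) := LinearEquiv.ofFinrankEq _ _ hK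
  -- `Q` extends coordinates on the Hamiltonian vectors to the whole space, and `V` lifts these
  -- coordinates back to covectors.
  obtain ⟨Q, hQ⟩ := LinearMap.exists_extend (e : K →ₗ[ℂ] (Fin (maxLeafDim s k) → ℂ))
  have hQ' : ∀ w : K, Q w = e w := fun w => LinearMap.congr_fun hQ w
  have hsurj : LinearMap.range (Q ∘ₗ sharp x) = ⊤ := by
    rw [LinearMap.range_eq_top]
    intro u
    obtain ⟨α, hα⟩ := (e.symm u).2
    refine ⟨α, ?_⟩
    rw [LinearMap.comp_apply, hα, hQ', e.apply_symm_apply]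
  obtain ⟨V, hV⟩ := (Q ∘ₗ sharp x).exists_rightInverse_of_surjective hsurj
  let P : Phase s k →ₗ[ℂ] (ConstraintIndex s k → ℂ) × (Fin (maxLeafDim s k) → ℂ) :=
    (LinearMap.pi fun i => (fderiv ℂ (constraintFun i) x).toLinearMap).prod Q
  have hinj : Function.Injective P := by
    rw [injective_iff_map_eq_zero]
    intro w hw
    have h1 := congrArg Prod.fst hw
    have h2 : Q w = 0 := congrArg Prod.snd hw
    have hwK : w ∈ K := (mem_range_sharp_iff hx hv).2 fun i => congrFun h1 i
    rw [hQ' ⟨w, hwK⟩] at h2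
    exact congrArg Subtype.val ((LinearEquiv.map_eq_zero_iff e).1 h2)
  have hdim : Module.finrank ℂ (Phase s k) =
      Module.finrank ℂ ((ConstraintIndex s k → ℂ) × (Fin (maxLeafDim s k) → ℂ)) := by
    have h := LinearMap.finrank_range_add_finrank_ker (sharp x)
    rw [finrank_ker_sharp hx hv, finrank_range_sharp hx hv,
      ← LinearEquiv.finrank_eq (LinearMap.toContinuousLinearMap (𝕜 := ℂ) (E := Phase s k)
      (F' := ℂ)), Subspace.dual_finrank_eq] at h
    rw [Module.finrank_prod, ← h, Module.finrank_fin_fun, add_comm,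
      Module.finrank_fintype_fun_eq_card]
  refine ⟨LinearMap.toContinuousLinearMap Q, V,
    (LinearEquiv.ofInjectiveOfFinrankEq P hinj hdim).toContinuousLinearEquiv,
    fun u => LinearMap.congr_fun hV u, fun w => rfl⟩

theorem eventually_det_ne_zero {X : Type*} [TopologicalSpace X] {n : Type*} [Fintype n]
    [DecidableEq n] {f : X → Matrix n n ℂ} (hf : Continuous f) {x : X} (hx : (f x).det ≠ 0) :
    ∀ᶠ y in 𝓝 x, (f y).det ≠ 0 :=
  hf.matrix_det.continuousAt.eventually_ne hx

theorem continuousOn_nonsing_inv {X : Type*} [TopologicalSpace X] {n : Type*} [Fintype n]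
    [DecidableEq n] {f : X → Matrix n n ℂ} {S : Set X} (hf : ContinuousOn f S)
    (h0 : ∀ y ∈ S, (f y).det ≠ 0) : ContinuousOn (fun y => (f y)⁻¹) S := by
  simp only [Matrix.inv_def, Ring.inverse_eq_inv']
  exact ((continuous_id.matrix_det.comp_continuousOn hf).inv₀ h0).smul
    (continuous_id.matrix_adjugate.comp_continuousOn hf)

/-- The constraints together with `Q` are local coordinates. Freezing the constraints at their
values at `x` gives the chart; its tangent spaces lie in the common kernel of the constraint
differentials, which consists of the Hamiltonian vectors, and agree with it by dimension. -/
theorem leafHasDim_of_krylov {x : Phase s k} (hx : x ∈ restrictedPhase s k)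
    {v : Fin k → ℂ} (hv : ∀ j, (krylov (mon x j) v).det ≠ 0) :
    LeafHasDim x (maxLeafDim s k) := by
  obtain ⟨Q, V, Ψ', hQV, hΨ'⟩ := exists_leaf_coordinates hx hv
  let Ψ : Phase s k → (ConstraintIndex s k → ℂ) × (Fin (maxLeafDim s k) → ℂ) :=
    fun y => (fun i => constraintFun i y, Q y)
  have hΨc : ContDiffAt ℂ 1 Ψ x :=
    (contDiffAt_pi.2 fun i => contDiffAt_constraintFun hx i).prodMk Q.contDiff.contDiffAt
  have hΨd : HasFDerivAt Ψ (Ψ' : Phase s k →L[ℂ] _) x := by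
    have h : HasFDerivAt Ψ ((ContinuousLinearMap.pi fun i : ConstraintIndex s k =>
        fderiv ℂ (constraintFun i) x).prod Q) x :=
      (hasFDerivAt_pi.2 fun i => ((contDiffAt_constraintFun hx i).differentiableAt
        one_ne_zero).hasFDerivAt).prodMk Q.hasFDerivAt
    convert h using 1
    ext w : 1
    exact hΨ' w
  let ψ := hΨc.localInverse hΨd one_ne_zero
  have hψx : ψ (Ψ x) = x := hΨc.localInverse_apply_image hΨd one_ne_zero
  have hψc : ContDiffAt ℂ 1 ψ (Ψ x) := hΨc.to_localInverse hΨd one_ne_zero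
  have hψr : ∀ᶠ z in 𝓝 (Ψ x), Ψ (ψ z) = z :=
    (hΨc.hasStrictFDerivAt' hΨd one_ne_zero).eventually_right_inverse
  -- `T y` measures how `V` fails to lift `Q` at `y`. It is the identity at `x`, hence invertible
  -- nearby, and `V ∘ (T y)⁻¹` is a lift depending continuously on `y`.
  let T : Phase s k → Matrix (Fin (maxLeafDim s k)) (Fin (maxLeafDim s k)) ℂ :=
    fun y => LinearMap.toMatrix' (Q.toLinearMap ∘ₗ sharp y ∘ₗ V)
  have hT : ∀ y u, (T y).mulVec u = Q (sharp y (V u)) := fun y u =>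
    LinearMap.toMatrix'_mulVec _ _
  have hTc : Continuous T := by
    refine continuous_matrix fun i j => ?_
    simp only [T, LinearMap.toMatrix'_apply]
    exact (continuous_apply i).comp (Q.continuous.comp (continuous_sharp_apply _))
  have hTx : (T x).det ≠ 0 := by
    have : T x = 1 := by
      simp only [T]
      rw [← LinearMap.toMatrix'_id]
      congr 1
      exact LinearMap.ext hQV
    rw [this, Matrix.det_one]
    exact one_ne_zero
  have hW : ∀ᶠ y in 𝓝 x, (∀ j, (mon y j).det ≠ 0) ∧ (∀ j, (krylov (mon y j) v).det ≠ 0) ∧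
      (T y).det ≠ 0 :=
    (Filter.eventually_all.2 fun j => eventually_det_ne_zero (continuous_mon j) (hx.1 j)).and
      ((Filter.eventually_all.2 fun j => eventually_det_ne_zero
        ((continuous_krylov v).comp (continuous_mon j)) (hv j)).and
        (eventually_det_ne_zero hTc hTx))
  let ι : (Fin (maxLeafDim s k) → ℂ) → (ConstraintIndex s k → ℂ) × (Fin (maxLeafDim s k) → ℂ) :=
    fun u => ((Ψ x).1, Q x + u)
  have hι0 : ι 0 = Ψ x := Prod.ext rfl (add_zero _)
  have hιc : ContDiff ℂ 1 ι := contDiff_const.prodMk (contDiff_const.add contDiff_id)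
  let φ : (Fin (maxLeafDim s k) → ℂ) → Phase s k := fun u => ψ (ι u)
  have hφ0 : φ 0 = x := by simp only [φ, hι0, hψx]
  have hφc : ContDiffAt ℂ 1 φ 0 := by
    refine ContDiffAt.comp (0 : Fin (maxLeafDim s k) → ℂ) (g := ψ) (f := ι) ?_ hιc.contDiffAt
    rw [hι0]
    exact hψc
  have hι : Filter.Tendsto ι (𝓝 0) (𝓝 (Ψ x)) := by
    have := hιc.continuous.tendsto 0
    rwa [hι0] at this
  have hφ : Filter.Tendsto φ (𝓝 0) (𝓝 x) := by
    have := hφc.continuousAt.tendsto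
    rwa [hφ0] at this
  have hall := (hφc.eventually (by simp)).and ((hι.eventually hψr).and (hφ.eventually hW))
  obtain ⟨ε, hε, hball⟩ := Metric.eventually_nhds_iff_ball.1 hall
  set U := Metric.ball (0 : Fin (maxLeafDim s k) → ℂ) ε with hU
  have hUo : IsOpen U := Metric.isOpen_ball
  have hφd : ∀ u ∈ U, DifferentiableAt ℂ φ u := fun u hu =>
    (hball u hu).1.differentiableAt one_ne_zero
  have hφF : ∀ u ∈ U, ∀ i : ConstraintIndex s k, constraintFun i (φ u) = constraintFun i x :=
    fun u hu i => congrFun (congrArg Prod.fst (hball u hu).2.1) i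
  have hφQ : ∀ u ∈ U, Q (φ u) = Q x + u := fun u hu => congrArg Prod.snd (hball u hu).2.1
  have hφX : ∀ u ∈ U, φ u ∈ restrictedPhase s k := fun u hu =>
    ⟨(hball u hu).2.2.1, fun a b hab =>
      (hφF u hu (Sum.inr ⟨(a, b), hab⟩)).trans (hx.2 a b hab)⟩
  have hφv : ∀ u ∈ U, ∀ j, (krylov (mon (φ u) j) v).det ≠ 0 := fun u hu => (hball u hu).2.2.2.1
  have hφT : ∀ u ∈ U, (T (φ u)).det ≠ 0 := fun u hu => (hball u hu).2.2.2.2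
  have hQL : ∀ u ∈ U, ∀ w, Q (fderiv ℂ φ u w) = w := by
    intro u hu w
    have h1 : HasFDerivAt (fun z => Q (φ z)) (Q.comp (fderiv ℂ φ u)) u :=
      Q.hasFDerivAt.comp u (hφd u hu).hasFDerivAt
    have h2 : HasFDerivAt (fun z => Q (φ z))
        (ContinuousLinearMap.id ℂ (Fin (maxLeafDim s k) → ℂ)) u := by
      refine ((hasFDerivAt_id u).const_add (Q x)).congr_of_eventuallyEq ?_
      filter_upwards [hUo.mem_nhds hu] with z hz
      exact hφQ z hz
    exact congrArg (fun L => L w) (h1.unique h2)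
  have hFL : ∀ u ∈ U, ∀ w i, fderiv ℂ (constraintFun i) (φ u) (fderiv ℂ φ u w) = 0 := by
    intro u hu w i
    have h1 : HasFDerivAt (fun z => constraintFun i (φ z))
        ((fderiv ℂ (constraintFun i) (φ u)).comp (fderiv ℂ φ u)) u :=
      ((contDiffAt_constraintFun (hφX u hu) i).differentiableAt
        one_ne_zero).hasFDerivAt.comp u (hφd u hu).hasFDerivAt
    have h2 : HasFDerivAt (fun z => constraintFun i (φ z))
        (0 : (Fin (maxLeafDim s k) → ℂ) →L[ℂ] ℂ) u := by
      refine (hasFDerivAt_const (constraintFun i x) u).congr_of_eventuallyEq ?_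
      filter_upwards [hUo.mem_nhds hu] with z hz
      exact hφF z hz i
    exact congrArg (fun L => L w) (h1.unique h2)
  have hLinj : ∀ u ∈ U, Function.Injective (fderiv ℂ φ u) := fun u hu =>
    Function.LeftInverse.injective (hQL u hu)
  have hrange : ∀ u ∈ U, LinearMap.range (fderiv ℂ φ u).toLinearMap =
      LinearMap.range (sharp (φ u)) := by
    intro u hu
    refine Submodule.eq_of_le_of_finrank_eq ?_ ?_
    · rintro _ ⟨w, rfl⟩
      exact (mem_range_sharp_iff (hφX u hu) (hφv u hu)).2 (hFL u hu w)
    · rw [finrank_range_sharp (hφX u hu) (hφv u hu), LinearMap.finrank_range_of_inj (hLinj u hu),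
        Module.finrank_fin_fun]
  refine ⟨U, φ, hUo, Metric.mem_ball_self hε, hφ0, ?_, fun u hu =>
    (hφd u hu).differentiableWithinAt, fun u hu => ⟨?_, hLinj u hu, ?_⟩⟩
  · intro u hu u' hu' h
    have := hφQ u hu
    rw [h, hφQ u' hu'] at this
    exact (add_left_cancel this).symm
  · have hmem : ∀ t ∈ Set.Icc (0 : ℝ) 1, ((t : ℂ) • u) ∈ U := by
      intro t ht
      rw [hU, mem_ball_zero_iff, norm_smul, Complex.norm_real, Real.norm_of_nonneg ht.1]
      exact (mul_le_of_le_one_left (norm_nonneg u) ht.2).trans_lt (mem_ball_zero_iff.1 hu)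
    have hline : ∀ t : ℝ, HasDerivAt (fun t : ℝ => (t : ℂ) • u) u t := fun t => by
      simpa using Complex.ofRealCLM.hasDerivAt (x := t) |>.smul_const u
    have hγ : ∀ t ∈ Set.Icc (0 : ℝ) 1, HasDerivAt (fun t : ℝ => φ ((t : ℂ) • u))
        (fderiv ℂ φ ((t : ℂ) • u) u) t := by
      intro t ht
      have h := (hφd _ (hmem t ht)).hasFDerivAt.restrictScalars ℝ
      exact h.comp_hasDerivAt t (hline t)
    -- The cotangent path lies over the image of the segment from `0` to `u`, with covectors given
    -- by the corrected lift of `u`.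
    refine ⟨fun t => φ ((t : ℂ) • u), fun t => V ((T (φ ((t : ℂ) • u)))⁻¹.mulVec u), ?_, ?_, ?_,
      fun t ht => ⟨hφX _ (hmem t ht), ?_⟩⟩
    · refine (LinearMap.continuous_of_finiteDimensional V).comp_continuousOn ?_
      have h1 : ContinuousOn (fun t : ℝ => T (φ ((t : ℂ) • u))) (Set.Icc 0 1) :=
        hTc.comp_continuousOn fun t ht => (hγ t ht).continuousAt.continuousWithinAt
      exact (continuous_id.matrix_mulVec continuous_const).comp_continuousOn
        (continuousOn_nonsing_inv h1 fun t ht => hφT _ (hmem t ht))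
    · simp [hφ0]
    · simp
    · have hu' := hmem t ht
      have h : sharp (φ ((t : ℂ) • u)) (V ((T (φ ((t : ℂ) • u)))⁻¹.mulVec u)) =
          fderiv ℂ φ ((t : ℂ) • u) u := by
        -- Both sides lie in the range of the derivative of `φ`, where `Q` is injective, and `Q`
        -- sends both to `u`.
        have hm : sharp (φ ((t : ℂ) • u)) (V ((T (φ ((t : ℂ) • u)))⁻¹.mulVec u)) ∈
            LinearMap.range (fderiv ℂ φ ((t : ℂ) • u)).toLinearMap := by
          rw [hrange _ hu']
          exact ⟨_, rfl⟩
        obtain ⟨w, hw⟩ := hm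
        change fderiv ℂ φ ((t : ℂ) • u) w = _ at hw
        have hQw := hQL _ hu' w
        rw [hw, ← hT, Matrix.mulVec_mulVec, Matrix.mul_nonsing_inv _
          (isUnit_iff_ne_zero.2 (hφT _ hu')), Matrix.one_mulVec] at hQw
        rw [← hw, hQw]
      rw [h]
      exact (hγ t ht).hasDerivWithinAt
  · exact congrArg (fun S : Submodule ℂ (Phase s k) => (S : Set (Phase s k))) (hrange u hu)

/-! ### An anti-triangular matrix with a cyclic vector -/

/-- The anti-triangular matrix with entries `1` on the main anti-diagonal and on the next one. -/
def zigzag (k : ℕ) : Matrix (Fin k) (Fin k) ℂ :=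
  Matrix.of fun a b => if (a : ℕ) + b + 1 = k ∨ (a : ℕ) + b + 2 = k then 1 else 0

/-- The `n`-th standard basis vector, counted from `0`. -/
def stdVec (k n : ℕ) : Fin k → ℂ := fun a => if (a : ℕ) = n then 1 else 0

theorem antiTriangular_zigzag (k : ℕ) : AntiTriangular (zigzag k) := by
  intro a b h
  unfold BelowAnti at h
  exact if_neg (by omega)

theorem det_zigzag_ne_zero (k : ℕ) : (zigzag k).det ≠ 0 := by
  refine (antiTriangular_zigzag k).det_ne_zero_iff.2 fun a => ?_
  have : zigzag k a (Fin.rev a) = 1 := if_pos (Or.inl (by rw [Fin.val_rev]; omega))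
  rw [this]
  exact one_ne_zero

theorem zigzag_mulVec_stdVec {b : ℕ} (hb : b < k) :
    (zigzag k).mulVec (stdVec k b) =
      stdVec k (k - 1 - b) + if b + 1 < k then stdVec k (k - 2 - b) else 0 := by
  have h : stdVec k b = Pi.single ⟨b, hb⟩ 1 := by
    funext a
    simp [stdVec, Pi.single_apply, Fin.ext_iff]
  rw [h, Matrix.mulVec_single_one]
  funext a
  have ha := a.2
  change (if (a : ℕ) + b + 1 = k ∨ (a : ℕ) + b + 2 = k then (1 : ℂ) else 0) = _
  by_cases h1 : b + 1 < k
  · simp only [if_pos h1, Pi.add_apply, stdVec]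
    split_ifs <;> first | omega | simp
  · simp only [if_neg h1, Pi.add_apply, stdVec, Pi.zero_apply]
    split_ifs <;> first | omega | simp

/-- The span of the first `n` iterates of a vector. -/
def iterateSpan (M : Matrix (Fin k) (Fin k) ℂ) (v : Fin k → ℂ) (n : ℕ) :
    Submodule ℂ (Fin k → ℂ) :=
  Submodule.span ℂ {u | ∃ i < n, (M ^ i).mulVec v = u}

theorem iterateSpan_mono (M : Matrix (Fin k) (Fin k) ℂ) (v : Fin k → ℂ) :
    Monotone (iterateSpan M v) := by
  intro m n h
  refine Submodule.span_mono ?_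
  rintro _ ⟨i, hi, rfl⟩
  exact ⟨i, hi.trans_le h, rfl⟩

theorem mulVec_mem_iterateSpan {M : Matrix (Fin k) (Fin k) ℂ} {v u : Fin k → ℂ} {n : ℕ}
    (hu : u ∈ iterateSpan M v n) : M.mulVec u ∈ iterateSpan M v (n + 1) := by
  unfold iterateSpan at hu
  induction hu using Submodule.span_induction with
  | mem u h =>
    obtain ⟨i, hi, rfl⟩ := h
    refine Submodule.subset_span ⟨i + 1, by omega, ?_⟩
    rw [Matrix.mulVec_mulVec, pow_succ']
  | zero => simp
  | add a b _ _ h1 h2 => rw [Matrix.mulVec_add]; exact add_mem h1 h2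
  | smul r a _ h => rw [Matrix.mulVec_smul]; exact Submodule.smul_mem _ _ h

/-- The iterates of the last basis vector reach new basis vectors alternately from the two ends:
`e_{k-1}, e_0, e_{k-2}, e_1, …`. Each application gives one new vector plus one already in the span.
-/
theorem stdVec_mem_iterateSpan_zigzag {m : ℕ} (hm : m < k) :
    stdVec k (k - 1 - m) ∈ iterateSpan (zigzag k) (stdVec k (k - 1)) (2 * m + 1) ∧
      stdVec k m ∈ iterateSpan (zigzag k) (stdVec k (k - 1)) (2 * m + 2) := by
  induction m with
  | zero =>
    have h : stdVec k (k - 1) ∈ iterateSpan (zigzag k) (stdVec k (k - 1)) 1 :=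
      Submodule.subset_span ⟨0, by omega, by simp⟩
    refine ⟨h, ?_⟩
    have h1 := mulVec_mem_iterateSpan h
    rw [zigzag_mulVec_stdVec (by omega), if_neg (by omega), add_zero, Nat.sub_self] at h1
    exact h1
  | succ m ih =>
    obtain ⟨h1, h2⟩ := ih (by omega)
    have h3 := mulVec_mem_iterateSpan h2
    rw [zigzag_mulVec_stdVec (by omega), if_pos hm] at h3
    have h4 := sub_mem h3 (iterateSpan_mono _ _ (by omega) h1)
    rw [add_sub_cancel_left, show k - 2 - m = k - 1 - (m + 1) by omega] at h4
    refine ⟨h4, ?_⟩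
    have h5 := mulVec_mem_iterateSpan h4
    rw [zigzag_mulVec_stdVec (by omega), if_pos (by omega),
      show k - 1 - (k - 1 - (m + 1)) = m + 1 by omega,
      show k - 2 - (k - 1 - (m + 1)) = m by omega] at h5
    have h6 := sub_mem h5 (iterateSpan_mono _ _ (by omega) h2)
    rw [add_sub_cancel_right] at h6
    exact h6

theorem det_krylov_zigzag_ne_zero (k : ℕ) :
    (krylov (zigzag k) (stdVec k (k - 1))).det ≠ 0 := by
  intro h
  obtain ⟨w, hw, h0⟩ := Matrix.exists_vecMul_eq_zero_iff.2 h
  have hspan : ∀ u ∈ iterateSpan (zigzag k) (stdVec k (k - 1)) k, w ⬝ᵥ u = 0 := by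
    intro u hu
    unfold iterateSpan at hu
    induction hu using Submodule.span_induction with
    | mem u h =>
      obtain ⟨i, hi, rfl⟩ := h
      exact congrFun h0 ⟨i, hi⟩
    | zero => simp
    | add a b _ _ h1 h2 => rw [dotProduct_add, h1, h2, add_zero]
    | smul r a _ h => rw [dotProduct_smul, h, smul_zero]
  refine hw (funext fun a => ?_)
  have ha : stdVec k a ∈ iterateSpan (zigzag k) (stdVec k (k - 1)) k := by
    by_cases h : 2 * (a : ℕ) + 2 ≤ k
    · exact iterateSpan_mono _ _ h (stdVec_mem_iterateSpan_zigzag a.2).2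
    · have := (stdVec_mem_iterateSpan_zigzag (k := k) (m := k - 1 - a) (by omega)).1
      rw [show k - 1 - (k - 1 - (a : ℕ)) = a by omega] at this
      exact iterateSpan_mono _ _ (by omega) this
  have := hspan _ ha
  have e : stdVec k a = Pi.single a 1 := by
    funext b
    simp [stdVec, Pi.single_apply, Fin.ext_iff]
  rwa [e, dotProduct_single_one] at this

/-! ### Density of the cyclic points -/

theorem list_prod_eq_mul_mul {R : Type*} [Monoid R] {n : ℕ} (f : Fin n → R) (j : Fin n) :
    (List.ofFn f).prod = (List.ofFn fun i => if i < j then f i else 1).prod * f j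
      * (List.ofFn fun i => if j < i then f i else 1).prod := by
  induction n with
  | zero => exact j.elim0
  | succ n ih =>
    refine Fin.cases ?_ (fun j => ?_) j
    · simp [List.ofFn_succ, Fin.succ_pos]
    · rw [List.ofFn_succ, List.prod_cons, ih (fun i => f i.succ) j]
      simp [List.ofFn_succ, Fin.succ_pos, Fin.succ_lt_succ_iff, mul_assoc]

theorem list_prod_smul {n : ℕ} (c : Fin n → ℂ) (f : Fin n → Matrix (Fin k) (Fin k) ℂ) :
    (List.ofFn fun i => c i • f i).prod = (∏ i, c i) • (List.ofFn f).prod := by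
  induction n with
  | zero => simp
  | succ n ih =>
    rw [List.ofFn_succ, List.prod_cons, ih, Fin.prod_univ_succ, List.ofFn_succ, List.prod_cons,
      smul_mul_smul_comm]

theorem krylov_smul (c : ℂ) (M : Matrix (Fin k) (Fin k) ℂ) (v : Fin k → ℂ) :
    krylov (c • M) v = krylov M v * Matrix.diagonal fun p : Fin k => c ^ (p : ℕ) := by
  ext a p
  rw [Matrix.mul_diagonal]
  simp [krylov, smul_pow, Matrix.smul_mulVec, mul_comm]

theorem det_krylov_smul_ne_zero {c : ℂ} (hc : c ≠ 0) {M : Matrix (Fin k) (Fin k) ℂ}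
    {v : Fin k → ℂ} (h : (krylov M v).det ≠ 0) : (krylov (c • M) v).det ≠ 0 := by
  rw [krylov_smul, Matrix.det_mul, Matrix.det_diagonal]
  exact mul_ne_zero h (Finset.prod_ne_zero_iff.2 fun _ _ => pow_ne_zero _ hc)

theorem eventually_ne_zero_of_entire {f : ℂ → ℂ} (hf : Differentiable ℂ f) {a : ℂ} (ha : f a ≠ 0)
    (b : ℂ) : ∀ᶠ t in 𝓝[≠] b, f t ≠ 0 := by
  refine ((hf.analyticAt b).eventually_eq_zero_or_eventually_ne_zero).resolve_left fun h => ha ?_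
  have hA : AnalyticOnNhd ℂ f Set.univ := fun z _ => hf.analyticAt z
  exact hA.eqOn_zero_of_preconnected_of_eventuallyEq_zero isPreconnected_univ (Set.mem_univ b) h
    (Set.mem_univ a)

theorem EntrywiseSmooth.continuous {E : Type*} [NormedAddCommGroup E] [NormedSpace ℂ E]
    {f : E → Matrix (Fin k) (Fin k) ℂ} (hf : EntrywiseSmooth f) : Continuous f :=
  continuous_matrix fun a b => (hf a b).continuous

theorem EntrywiseSmooth.krylov {E : Type*} [NormedAddCommGroup E] [NormedSpace ℂ E]
    {f : E → Matrix (Fin k) (Fin k) ℂ} (hf : EntrywiseSmooth f) (v : Fin k → ℂ) :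
    EntrywiseSmooth fun y => MonodromyAlgebra.krylov (f y) v := by
  intro a p
  simp only [MonodromyAlgebra.krylov, Matrix.of_apply, Matrix.mulVec, dotProduct]
  exact ContDiff.sum fun b _ => (hf.pow p a b).mul contDiff_const

/-- The other matrices are deformed linearly to `1` and the boundary matrix to `zigzag k`, through
anti-triangular matrices; the `j`-th matrix is solved from the product. At `t = 1` it would be
`zigzag k`, which is cyclic, so cyclicity can fail only at isolated times. -/
theorem mem_closure_krylov {x : Phase s k} (hx : x ∈ restrictedPhase s k) (j : Fin s) :
    x ∈ closure {y | y ∈ restrictedPhase s k ∧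
      (krylov (mon y j) (stdVec k (k - 1))).det ≠ 0} := by
  let A : Fin s → ℂ → Matrix (Fin k) (Fin k) ℂ := fun i t => (1 - t) • mon x i + t • 1
  have hA : ∀ i, EntrywiseSmooth (A i) := fun i =>
    (EntrywiseSmooth.smul (contDiff_const.sub contDiff_id) (EntrywiseSmooth.const _)).add
      (EntrywiseSmooth.smul contDiff_id (EntrywiseSmooth.const _))
  let P : ℂ → Matrix (Fin k) (Fin k) ℂ := fun t =>
    (List.ofFn fun i => if i < j then A i t else 1).prod
  let R : ℂ → Matrix (Fin k) (Fin k) ℂ := fun t =>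
    (List.ofFn fun i => if j < i then A i t else 1).prod
  have hP : EntrywiseSmooth P := by
    refine EntrywiseSmooth.list_prod (f := fun i t => if i < j then A i t else 1) fun i => ?_
    split_ifs
    exacts [hA i, EntrywiseSmooth.const _]
  have hR : EntrywiseSmooth R := by
    refine EntrywiseSmooth.list_prod (f := fun i t => if j < i then A i t else 1) fun i => ?_
    split_ifs
    exacts [hA i, EntrywiseSmooth.const _]
  let B : ℂ → Matrix (Fin k) (Fin k) ℂ := fun t => (1 - t) • boundary x + t • zigzag k
  have hB : EntrywiseSmooth B :=
    (EntrywiseSmooth.smul (contDiff_const.sub contDiff_id) (EntrywiseSmooth.const _)).add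
      (EntrywiseSmooth.smul contDiff_id (EntrywiseSmooth.const _))
  -- Adjugates in place of inverses make `N` entire, including where `P` or `R` is singular. The
  -- scalar `δ` is restored only near `t = 0`, and scaling does not affect cyclicity.
  let N : ℂ → Matrix (Fin k) (Fin k) ℂ := fun t => (P t).adjugate * B t * (R t).adjugate
  have hN : EntrywiseSmooth N := (hP.adjugate.mul hB).mul hR.adjugate
  let δ : ℂ → ℂ := fun t => (P t).det * (R t).det
  have hδ : Continuous δ := hP.continuous.matrix_det.mul hR.continuous.matrix_det
  let y : ℂ → Phase s k := fun t c =>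
    if c.1 = j then ((δ t)⁻¹ • N t) c.2.1 c.2.2 else A c.1 t c.2.1 c.2.2
  have hyj : ∀ t, mon (y t) j = (δ t)⁻¹ • N t := by
    intro t
    ext a b
    simp [mon, y]
  have hyi : ∀ t i, i ≠ j → mon (y t) i = A i t := by
    intro t i hi
    ext a b
    simp [mon, y, hi]
  have hA0 : ∀ i, A i 0 = mon x i := fun i => by simp [A]
  have hPR : P 0 * mon x j * R 0 = boundary x := by
    simp only [P, R, hA0]
    exact (list_prod_eq_mul_mul (mon x) j).symm
  have hδ0 : δ 0 ≠ 0 := by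
    intro h
    refine det_boundary_ne_zero hx ?_
    rw [← hPR, Matrix.det_mul, Matrix.det_mul, mul_right_comm]
    exact mul_eq_zero_of_left h _
  have hy0 : y 0 = x := by
    have h : ∀ i, mon (y 0) i = mon x i := by
      intro i
      by_cases hi : i = j
      · subst hi
        have e : N 0 = δ 0 • mon x i := by
          simp only [N, B, sub_zero, one_smul, zero_smul, add_zero]
          rw [← hPR, Matrix.mul_assoc (P 0), ← Matrix.mul_assoc (P 0).adjugate,
            Matrix.adjugate_mul, Matrix.mul_assoc, Matrix.mul_assoc (mon x i), Matrix.mul_adjugate]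
          simp [δ, smul_smul, mul_comm]
        rw [hyj, e, smul_smul, inv_mul_cancel₀ hδ0, one_smul]
      · rw [hyi 0 i hi, hA0]
    funext c
    exact congrFun (congrFun (h c.1) c.2.1) c.2.2
  have hyc : ContinuousAt y 0 := by
    refine continuousAt_pi.2 fun c => ?_
    by_cases hc : c.1 = j
    · simp only [y, if_pos hc, Matrix.smul_apply, smul_eq_mul]
      exact (hδ.continuousAt.inv₀ hδ0).mul (hN _ _).continuous.continuousAt
    · simp only [y, if_neg hc]
      exact (hA c.1 _ _).continuous.continuousAt
  have hyb : ∀ t, δ t ≠ 0 → boundary (y t) = B t := by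
    intro t ht
    have h1 : (List.ofFn fun i => if i < j then mon (y t) i else 1).prod = P t := by
      simp only [P]
      congr 2
      funext i
      split_ifs with h
      exacts [hyi t i h.ne, rfl]
    have h2 : (List.ofFn fun i => if j < i then mon (y t) i else 1).prod = R t := by
      simp only [R]
      congr 2
      funext i
      split_ifs with h
      exacts [hyi t i h.ne', rfl]
    rw [boundary, list_prod_eq_mul_mul _ j, h1, h2, hyj]
    simp only [N, mul_smul_comm, smul_mul_assoc]
    rw [← Matrix.mul_assoc, ← Matrix.mul_assoc, Matrix.mul_adjugate, Matrix.mul_assoc,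
      Matrix.adjugate_mul]
    simp only [mul_smul_comm, smul_mul_assoc, one_mul, mul_one, smul_smul]
    rw [show (δ t)⁻¹ * ((R t).det * (P t).det) = 1 by
      rw [mul_comm (R t).det]
      exact inv_mul_cancel₀ ht, one_smul]
  have hf : Differentiable ℂ fun t => (krylov (N t) (stdVec k (k - 1))).det :=
    ((hN.krylov _).det).differentiable one_ne_zero
  have hf1 : (krylov (N 1) (stdVec k (k - 1))).det ≠ 0 := by
    have e : N 1 = zigzag k := by simp [N, P, R, A, B, Matrix.adjugate_one]
    rw [e]
    exact det_krylov_zigzag_ne_zero k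
  have hyt : Filter.Tendsto y (𝓝[≠] 0) (𝓝 x) := by
    have := hyc.tendsto
    rw [hy0] at this
    exact this.mono_left nhdsWithin_le_nhds
  have hdet : ∀ᶠ z : Phase s k in 𝓝 x, ∀ i, (mon z i).det ≠ 0 :=
    Filter.eventually_all.2 fun i => eventually_det_ne_zero (continuous_mon i) (hx.1 i)
  refine mem_closure_of_tendsto hyt ?_
  filter_upwards [eventually_ne_zero_of_entire hf hf1 0, hyt.eventually hdet,
    (hδ.continuousAt.eventually_ne hδ0).filter_mono nhdsWithin_le_nhds] with t h1 h2 h3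
  refine ⟨⟨h2, fun a b hab => ?_⟩, ?_⟩
  · rw [hyb t h3]
    simp [B, hx.2 a b hab, antiTriangular_zigzag k a b hab]
  · rw [hyj]
    exact det_krylov_smul_ne_zero (inv_ne_zero h3) h1

/-- The points of the restricted phase space at which the last standard basis vector is cyclic for
all monodromy matrices. -/
def cyclicPhase (s k : ℕ) : Set (Phase s k) :=
  {x | x ∈ restrictedPhase s k ∧ ∀ j, (krylov (mon x j) (stdVec k (k - 1))).det ≠ 0}

theorem restrictedPhase_subset_closure_cyclicPhase :
    restrictedPhase s k ⊆ closure (cyclicPhase s k) := by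
  have h : ∀ J : Finset (Fin s), restrictedPhase s k ⊆ closure {x | x ∈ restrictedPhase s k ∧
      ∀ j ∈ J, (krylov (mon x j) (stdVec k (k - 1))).det ≠ 0} := by
    intro J
    induction J using Finset.induction_on with
    | empty => simpa using subset_closure
    | insert j J _ ih =>
      intro x hx
      refine mem_closure_iff.2 fun O hO hxO => ?_
      obtain ⟨y, hyO, hy, hyJ⟩ := mem_closure_iff.1 (ih hx) O hO hxO
      -- Cyclicity already achieved at the indices in `J` is open, so it survives the small move
      -- that makes the `j`-th matrix cyclic.
      have hopen : IsOpen {z : Phase s k |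
          ∀ i ∈ J, (krylov (mon z i) (stdVec k (k - 1))).det ≠ 0} := by
        simp only [Set.ofPred_forall]
        exact J.finite_toSet.isOpen_biInter fun i _ => isOpen_ne_fun
          ((continuous_krylov _).comp (continuous_mon i)).matrix_det continuous_const
      obtain ⟨z, ⟨hzO, hzJ⟩, hz, hzj⟩ :=
        mem_closure_iff.1 (mem_closure_krylov hy j) _ (hO.inter hopen) ⟨hyO, hyJ⟩
      exact ⟨z, hzO, hz, (Finset.forall_mem_insert _ _ _).2 ⟨hzj, hzJ⟩⟩
  exact (h Finset.univ).trans
    (closure_mono fun x hx => ⟨hx.1, fun j => hx.2 j (Finset.mem_univ j)⟩)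

/-! ### Determinant one -/

/-- The tuple of matrices divided by `k`-th roots of their determinants. -/
def normalize (x : Phase s k) : Phase s k :=
  fun c => (mon x c.1).det ^ (-(1 / (k : ℂ))) * x c

theorem mon_normalize (x : Phase s k) (j : Fin s) :
    mon (normalize x) j = (mon x j).det ^ (-(1 / (k : ℂ))) • mon x j := by
  ext a b
  rfl

theorem det_mon_normalize (hk : 1 ≤ k) {x : Phase s k} {j : Fin s} (hx : (mon x j).det ≠ 0) :
    (mon (normalize x) j).det = 1 := by
  have hk' : (k : ℂ) ≠ 0 := by exact_mod_cast (by omega : k ≠ 0)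
  rw [mon_normalize, Matrix.det_smul, Fintype.card_fin, ← Complex.cpow_mul_nat, neg_mul,
    one_div_mul_cancel hk', Complex.cpow_neg_one, inv_mul_cancel₀ hx]

theorem normalize_mem_restrictedPhaseSL (hk : 1 ≤ k) {x : Phase s k}
    (hx : x ∈ restrictedPhase s k) : normalize x ∈ restrictedPhaseSL s k := by
  refine ⟨⟨fun j => ?_, fun a b hab => ?_⟩, fun j => det_mon_normalize hk (hx.1 j)⟩
  · rw [det_mon_normalize hk (hx.1 j)]
    exact one_ne_zero
  · simp only [boundary, mon_normalize]
    rw [list_prod_smul, Matrix.smul_apply]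
    exact smul_eq_zero_of_right _ (hx.2 a b hab)

theorem normalize_mem_cyclicPhase (hk : 1 ≤ k) {x : Phase s k} (hx : x ∈ cyclicPhase s k) :
    normalize x ∈ cyclicPhase s k := by
  refine ⟨(normalize_mem_restrictedPhaseSL hk hx.1).1, fun j => ?_⟩
  rw [mon_normalize]
  exact det_krylov_smul_ne_zero (by simp [Complex.cpow_eq_zero_iff, hx.1.1 j]) (hx.2 j)

theorem normalize_eq_self {x : Phase s k} (hx : ∀ j, (mon x j).det = 1) : normalize x = x := by
  funext c
  simp [normalize, hx]

theorem continuousAt_normalize {x : Phase s k} (hx : ∀ j, (mon x j).det = 1) :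
    ContinuousAt normalize x := by
  refine continuousAt_pi.2 fun c => ContinuousAt.mul ?_ (continuous_apply c).continuousAt
  -- The principal power is continuous near determinant `1`, away from its branch cut; continuity
  -- elsewhere is not needed.
  refine ContinuousAt.cpow (continuous_mon c.1).matrix_det.continuousAt continuousAt_const ?_
  rw [hx]
  exact Complex.one_mem_slitPlane

/-- Normalization fixes `x`, is continuous there, and sends nearby cyclic points to cyclic points of
determinant one. -/
theorem restrictedPhaseSL_subset_closure_cyclicPhase (hk : 1 ≤ k) :
    restrictedPhaseSL s k ⊆ closure (restrictedPhaseSL s k ∩ cyclicPhase s k) := by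
  intro x hx
  have hmaps : Set.MapsTo normalize (cyclicPhase s k) (restrictedPhaseSL s k ∩ cyclicPhase s k) :=
    fun y hy => ⟨normalize_mem_restrictedPhaseSL hk hy.1, normalize_mem_cyclicPhase hk hy⟩
  have h := (continuousAt_normalize hx.2).continuousWithinAt.mem_closure
    (restrictedPhase_subset_closure_cyclicPhase hx.1) hmaps
  rwa [normalize_eq_self hx.2] at h

/-! ### Existence of points and the bound on leaf dimensions -/

theorem restrictedPhase_nonempty (hs : 1 ≤ s) : (restrictedPhase s k).Nonempty := by
  let j : Fin s := ⟨0, hs⟩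
  let x : Phase s k := fun c => (if c.1 = j then zigzag k else 1) c.2.1 c.2.2
  have hm : ∀ i, mon x i = if i = j then zigzag k else 1 := fun _ => rfl
  have hb : boundary x = zigzag k := by
    have h1 : (fun i => if i < j then mon x i else 1) = fun _ => 1 := by
      funext i
      split_ifs with h
      exacts [by rw [hm, if_neg h.ne], rfl]
    have h2 : (fun i => if j < i then mon x i else 1) = fun _ => 1 := by
      funext i
      split_ifs with h
      exacts [by rw [hm, if_neg h.ne'], rfl]
    rw [boundary, list_prod_eq_mul_mul _ j, h1, h2, hm]
    simp
  refine ⟨x, fun i => ?_, fun a b hab => ?_⟩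
  · rw [hm]
    split_ifs
    · exact det_zigzag_ne_zero k
    · simp
  · rw [hb]
    exact antiTriangular_zigzag k a b hab

/-- A leaf's dimension is the rank at its base point, and semicontinuity bounds it by the rank at
nearby cyclic points. -/
theorem leafHasDim_le {x : Phase s k} (hx : x ∈ restrictedPhase s k) {d : ℕ}
    (h : LeafHasDim x d) : d ≤ maxLeafDim s k := by
  rw [← h.finrank_range_sharp_eq]
  exact finrank_range_sharp_le_of_mem_closure
    (fun y hy => (finrank_range_sharp hy.1 hy.2).le)
    (restrictedPhase_subset_closure_cyclicPhase hx)

end MonodromyAlgebra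

end

open MonodromyAlgebra in
theorem mainTheorem5 (s k : ℕ) (hs : 1 ≤ s) (hk : 1 ≤ k) :
    -- the restriction is compatible with the bracket
    (∀ a b : Fin k, BelowAnti a b →
      IsCasimir (fun x : Phase s k => boundary x a b)) ∧
    -- the maximal dimension of the Poisson leaves, for invertible matrices
    IsGreatest {d : ℕ | ∃ x ∈ restrictedPhase s k, LeafHasDim x d} (maxLeafDim s k) ∧
    -- and for matrices of determinant one
    IsGreatest {d : ℕ | ∃ x ∈ restrictedPhaseSL s k, LeafHasDim x d} (maxLeafDim s k) ∧
    -- the ratios are well defined, and all listed functions are Casimirs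
    (∀ x ∈ restrictedPhase s k, ∀ i : Fin (k / 2),
      boundary x (Fin.rev (halfIndex i)) (halfIndex i) ≠ 0) ∧
    (∀ i, IsCasimir (casimirFun (s := s) (k := k) i)) ∧
    -- generically the leaf has maximal dimension, and the Casimirs are independent and complete
    restrictedPhase s k ⊆ closure {x | x ∈ restrictedPhase s k ∧
      LeafHasDim x (maxLeafDim s k) ∧ CasimirsCompleteAt x} ∧
    restrictedPhaseSL s k ⊆ closure {x | x ∈ restrictedPhaseSL s k ∧
      LeafHasDim x (maxLeafDim s k) ∧ CasimirsCompleteAt x} := by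
  have hd := (restrictedPhase_subset_closure_cyclicPhase (s := s) (k := k)).trans
    (closure_mono (t := {x | x ∈ restrictedPhase s k ∧
      LeafHasDim x (maxLeafDim s k) ∧ CasimirsCompleteAt x})
      fun x hx => ⟨hx.1, leafHasDim_of_krylov hx.1 hx.2, casimirsCompleteAt_of_krylov hx.1 hx.2⟩)
  have hdSL := (restrictedPhaseSL_subset_closure_cyclicPhase (s := s) hk).trans
    (closure_mono (t := {x | x ∈ restrictedPhaseSL s k ∧
      LeafHasDim x (maxLeafDim s k) ∧ CasimirsCompleteAt x})
      fun x hx => ⟨hx.1, leafHasDim_of_krylov hx.2.1 hx.2.2,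
        casimirsCompleteAt_of_krylov hx.2.1 hx.2.2⟩)
  obtain ⟨x₀, hx₀⟩ := restrictedPhase_nonempty (k := k) hs
  refine ⟨fun a b h => isCasimir_boundary h, ⟨?_, ?_⟩, ⟨?_, ?_⟩,
    fun x hx i => boundary_antidiagonal_ne_zero' hx _, isCasimir_casimirFun, hd, hdSL⟩
  · obtain ⟨x, hx, h, -⟩ := closure_nonempty_iff.1 ⟨x₀, hd hx₀⟩
    exact ⟨x, hx, h⟩
  · rintro d ⟨x, hx, h⟩
    exact leafHasDim_le hx h
  · obtain ⟨x, hx, h, -⟩ := closure_nonempty_iff.1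
      ⟨_, hdSL (normalize_mem_restrictedPhaseSL hk hx₀)⟩
    exact ⟨x, hx, h⟩
  · rintro d ⟨x, hx, h⟩
    exact leafHasDim_le hx.1 h
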